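/- Let $\mathbb K$ be a field of characteristic $0$, let $R=\mathbb K[x_1,\dots,x_k]$, let $n\ge 2$, and let $\mathcal A=\{\ell_1,\dots,\ell_n\}\subset R$ be a hyperplane arrangement, i.e. $\ell_1,\dots,\ell_n$ are linear forms with $\gcd(\ell_i,\ell_j)=1$ for all $i\ne j$. Let $I_{n-2}(\mathcal A)\subseteq R$ be the ideal generated by all products $\ell_{i_1}\cdots\ell_{i_{n-2}}$ with $1\le i_1<\dots<i_{n-2}\le n$ (with $I_0(\mathcal A)=R$). Let ${\rm rank}(\mathcal A)$ be the height of the ideal $\langle \ell_1,\dots,\ell_n\rangle$. Let $p(\mathcal A)$ be the dimension of the subspace of $\mathbb K^{\binom n2}$ (coordinates indexed by the pairs $i<j$) spanned by the following vectors: for every relation $c_1\ell_{i_1}+c_2\ell_{i_2}+c_3\ell_{i_3}=0$ with $i_1<i_2<i_3$ and $c_1,c_2,c_3\in\mathbb K\setminus\{0\}$, the vector with entry $c_3$ at $(i_1,i_2)$, $c_2$ at $(i_1,i_3)$, $c_1$ at $(i_2,i_3)$, and $0$ elsewhere. Then the ring $R/I_{n-2}(\mathcal A)$ is Cohen–Macaulay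 (the zero ring counting as Cohen–Macaulay) if and only if either (1) ${\rm rank}(\mathcal A)=2$ and $p(\mathcal A)=\binom{n-1}{2}$, or (2) ${\rm rank}(\mathcal A)\ge 3$ and $p(\mathcal A)=0$. Moreover, if ${\rm rank}(\mathcal A)=2$, then the equality $p(\mathcal A)=\binom{n-1}{2}$ in (1) holds automatically; and $p(\mathcal A)=0$ if and only if any three of the forms $\ell_1,\dots,\ell_n$ are linearly independent. -/

import Mathlib

namespace FoldProducts



/-- The depth (grade) of an ideal `I` of `A` on the ring `A` itself: the supremum of the lengths
of the `A`-regular sequences all of whose terms lie in `I`. -/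
noncomputable def depth {A : Type*} [CommRing A] (I : Ideal A) : ℕ∞ :=
  ⨆ rs : {rs : List A // RingTheory.Sequence.IsRegular A rs ∧ ∀ r ∈ rs, r ∈ I},
    (rs.1.length : ℕ∞)

/-- A Cohen–Macaulay ring: a Noetherian ring in which `depth P = height P` for every maximal
ideal `P` (equivalently, every localization at a maximal ideal is a Cohen–Macaulay local ring).
The zero ring is Cohen–Macaulay, as usual. -/
def IsCohenMacaulayRing (A : Type*) [CommRing A] : Prop :=
  IsNoetherianRing A ∧ ∀ P : Ideal A, P.IsMaximal → depth P = P.height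

section

variable {K : Type*} [Field K] {k n : ℕ}

/-- The forms `ℓ 0, …, ℓ (n - 1)` in `K[x₁, …, x_k]` define a central hyperplane arrangement:
they are linear forms, with `gcd (ℓ i, ℓ j) = 1` whenever `i ≠ j`. -/
structure IsArrangement (ℓ : Fin n → MvPolynomial (Fin k) K) : Prop where
  linear : ∀ i, (ℓ i).IsHomogeneous 1
  coprime : ∀ i j, i ≠ j → IsRelPrime (ℓ i) (ℓ j)

/-- The ideal `I_a` generated by the `a`-fold products of the forms `ℓ i`. It is the whole ring
for `a = 0` and the zero ideal for `a > n`. -/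
noncomputable def foldIdeal (ℓ : Fin n → MvPolynomial (Fin k) K) (a : ℕ) :
    Ideal (MvPolynomial (Fin k) K) :=
  Ideal.span {f | ∃ s : Finset (Fin n), s.card = a ∧ f = ∏ i ∈ s, ℓ i}

/-- The rank of the arrangement: the height of the ideal generated by its forms. -/
noncomputable def rank (ℓ : Fin n → MvPolynomial (Fin k) K) : ℕ∞ :=
  (Ideal.span (Set.range ℓ)).height

/-- The index set of `K ^ m` with `m = n.choose 2`: the pairs `i < j`. -/
abbrev Pairs (n : ℕ) : Type := {q : Fin n × Fin n // q.1 < q.2}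

/-- The vector in `K ^ m` of a 3-dependency `c₁ ℓ i₁ + c₂ ℓ i₂ + c₃ ℓ i₃ = 0`, `i₁ < i₂ < i₃`: it
has entry `c₃` in position `(i₁, i₂)`, `c₂` in position `(i₁, i₃)`, `c₁` in position `(i₂, i₃)`,
and zeros elsewhere. -/
def circuitVector {i₁ i₂ i₃ : Fin n} (h₁₂ : i₁ < i₂) (h₂₃ : i₂ < i₃) (c₁ c₂ c₃ : K) :
    Pairs n → K :=
  Pi.single ⟨(i₁, i₂), h₁₂⟩ c₃ + Pi.single ⟨(i₁, i₃), h₁₂.trans h₂₃⟩ c₂ +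
    Pi.single ⟨(i₂, i₃), h₂₃⟩ c₁

/-- The subspace of `K ^ m` spanned by the vectors of all 3-dependencies, that is, of all linear
relations among exactly three of the forms (all three coefficients being nonzero). -/
def dependencySpace (ℓ : Fin n → MvPolynomial (Fin k) K) : Submodule K (Pairs n → K) :=
  Submodule.span K {v | ∃ (i₁ i₂ i₃ : Fin n) (h₁₂ : i₁ < i₂) (h₂₃ : i₂ < i₃) (c₁ c₂ c₃ : K),
    c₁ ≠ 0 ∧ c₂ ≠ 0 ∧ c₃ ≠ 0 ∧ c₁ • ℓ i₁ + c₂ • ℓ i₂ + c₃ • ℓ i₃ = 0 ∧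
    v = circuitVector h₁₂ h₂₃ c₁ c₂ c₃}

/-- The number `p` of independent 3-dependencies of the arrangement. -/
noncomputable def numDependencies (ℓ : Fin n → MvPolynomial (Fin k) K) : ℕ :=
  Module.finrank K (dependencySpace ℓ)

end

end FoldProducts

/-! The coprime linear forms are nonzero vectors, pairwise independent, and the rank is the
dimension of their span; it is at least 2, so only rank 2 and rank at least 3 occur.

Positive direction. Suppose any `c` of the forms are independent. Since `K` is infinite, `k - c`
linear forms `θ` can be chosen that complement the span of every `c` forms of the arrangement. Let
`S = K[θ]`. Then `R/(q) ≅ S` for each set `q` of `c` forms, and `R` modulo the products of all but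
`c - 1` forms is built from these quotients by short exact sequences (colon by a form, then adding
the form). All of these split over `S`, so the quotient is finite projective over a polynomial ring,
hence Cohen–Macaulay. The inductive scheme is `foldIdealOn_induction`. For `c = 3` this is the case
`p = 0`. In rank 2, one form can be dropped without changing `I_{n-2}`, and `c = 2` applies to the
other `n - 1` forms.

Negative direction. If one triple is dependent and another independent, the dependent one gives a
prime of height 2 over `I_{n-2}`, so the quotient has height at least `k - 2` at the origin. The
product of the forms outside the independent triple has an annihilator modulo `I_{n-2}` that
contains this triple, which gives an associated prime of height at least 3 through the origin. By
`height_add_length_le` the depth there is at most `k - 3`.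

In rank 2, rescaling coordinates by determinants turns the dependency space into the cycle space of
the complete graph on `n` vertices, of dimension `(n-1).choose 2`. -/

namespace FoldProducts

open RingTheory.Sequence
open scoped Pointwise

/-! ### Associated primes bound the length of regular sequences -/

section CommutativeAlgebra

variable {R M : Type*} [CommRing R] [IsNoetherianRing R] [AddCommGroup M] [Module R M]
  [Module.Finite R M]

/-- A minimal prime over the annihilator of a finite module is the annihilator of an element. -/
lemma exists_smul_eq_zero_iff_of_mem_minimalPrimes {P : Ideal R}
    (hP : P ∈ (Module.annihilator R M).minimalPrimes) :
    ∃ x : M, ∀ r : R, r • x = 0 ↔ r ∈ P := by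
  have h := Module.associatedPrimes.minimalPrimes_annihilator_subset_associatedPrimes R M hP
  obtain ⟨-, x, hx⟩ := isAssociatedPrime_iff.1 h
  refine ⟨x, fun r => ?_⟩
  rw [hx]
  simp [Submodule.mem_colon_singleton]

/-- Let `N` be the submodule killed by `P` and `N'` its image in `M/yM`. The annihilator of `N'`
contains `P` and `y`, and `y ∉ P` by regularity, so any prime over it is strictly larger than `P`.
That such a prime fits inside `m` is Nakayama's lemma, done by the determinant trick instead of
localizing. -/
lemma exists_lt_annihilator_prime_quotSMulTop {m P : Ideal R} [m.IsPrime] [P.IsPrime]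
    (hPm : P ≤ m) {x : M} (hx : ∀ r : R, r • x = 0 ↔ r ∈ P) {y : R} (hym : y ∈ m)
    (hy : IsSMulRegular M y) :
    ∃ P' : Ideal R, P'.IsPrime ∧ P < P' ∧ P' ≤ m ∧
      ∃ z : QuotSMulTop y M, ∀ r : R, r • z = 0 ↔ r ∈ P' := by
  let N : Submodule R M :=
    { carrier := {v | ∀ r ∈ P, r • v = 0}
      zero_mem' := fun r _ => smul_zero r
      add_mem' := fun {a b} ha hb r hr => by rw [smul_add, ha r hr, hb r hr, add_zero]
      smul_mem' := fun c a ha r hr => by rw [smul_comm, ha r hr, smul_zero] }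
  let N' : Submodule R (QuotSMulTop y M) := N.map (Submodule.mkQ _)
  have hann : Module.annihilator R N' ≤ m := by
    intro s hs
    have hsN : ∀ v ∈ N, ∃ w ∈ N, s • v = y • w := by
      intro v hv
      have h0 := Module.mem_annihilator.1 hs ⟨Submodule.mkQ _ v, Submodule.mem_map_of_mem hv⟩
      have h1 : Submodule.mkQ (y • ⊤ : Submodule R M) (s • v) = 0 := by
        rw [map_smul]; exact congrArg Subtype.val h0
      rw [Submodule.mkQ_apply, Submodule.Quotient.mk_eq_zero] at h1
      obtain ⟨w, -, hw⟩ := h1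
      have hw' : y • w = s • v := hw
      -- `N ∩ yM = yN`: if `P` kills `y • w`, then `P` kills `w`, because `y` is regular.
      refine ⟨w, fun r hr => hy ?_, hw'.symm⟩
      change y • r • w = y • (0 : M)
      rw [smul_comm, hw', smul_comm, hv r hr, smul_zero, smul_zero]
    -- Since `sN ⊆ yN`, Cayley–Hamilton gives a monic `p` with lower coefficients in `(y) ⊆ m` and
    -- `p(s) = 0` on `N`. Applied to `x`, this gives `p(s) ∈ P ⊆ m`, hence a power of `s` lies in
    -- `m`.
    obtain ⟨p, hp, -, hpc, hp0⟩ :=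
      LinearMap.exists_monic_and_natDegree_eq_and_coeff_mem_pow_and_aeval_eq_zero R
        (algebraMap R (Module.End R N) s) (Ideal.span {y}) (by
          rintro _ ⟨v, rfl⟩
          obtain ⟨w, hw, hvw⟩ := hsN v v.2
          have : (algebraMap R (Module.End R N) s) v = y • (⟨w, hw⟩ : N) := Subtype.ext hvw
          rw [this]
          exact Submodule.smul_mem_smul (Ideal.mem_span_singleton_self y) trivial)
    rw [Polynomial.aeval_algebraMap_apply] at hp0
    have hxN : x ∈ N := fun r hr => (hx r).2 hr
    have h1 : Polynomial.aeval s p ∈ P := by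
      rw [← hx]
      exact congrArg Subtype.val (LinearMap.congr_fun hp0 ⟨x, hxN⟩)
    have h2 : Polynomial.aeval s p - s ^ p.natDegree ∈ m := by
      rw [Polynomial.aeval_eq_sum_range, Finset.sum_range_succ, hp.coeff_natDegree, one_smul,
        add_sub_cancel_right]
      refine Ideal.sum_mem _ fun i hi => ?_
      rw [smul_eq_mul]
      refine m.mul_mem_right _ ((Ideal.span_singleton_le_iff_mem m).2 hym ?_)
      exact Ideal.pow_le_self (by have := Finset.mem_range.1 hi; omega) (hpc i)
    have h3 : s ^ p.natDegree ∈ m := by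
      have := m.sub_mem (hPm h1) h2
      rwa [sub_sub_cancel] at this
    exact Ideal.IsPrime.mem_of_pow_mem ‹_› _ h3
  obtain ⟨P', hP', hP'm⟩ := Ideal.exists_minimalPrimes_le hann
  obtain ⟨z, hz⟩ := exists_smul_eq_zero_iff_of_mem_minimalPrimes hP'
  have hPP' : P ≤ P' := by
    refine le_trans (fun r hr => Module.mem_annihilator.2 ?_) hP'.1.2
    rintro ⟨_, v, hv, rfl⟩
    refine Subtype.ext ?_
    change r • Submodule.mkQ _ v = 0
    rw [← map_smul, hv r hr, map_zero]
  have hyP' : y ∈ P' := by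
    refine hP'.1.2 (Module.mem_annihilator.2 ?_)
    rintro ⟨_, v, hv, rfl⟩
    refine Subtype.ext ?_
    change y • Submodule.mkQ _ v = 0
    rw [← map_smul, Submodule.mkQ_apply, Submodule.Quotient.mk_eq_zero]
    exact Submodule.smul_mem_pointwise_smul _ _ _ trivial
  have hyP : y ∉ P := by
    intro h
    have h0 : x = 0 := hy (((hx y).2 h).trans (smul_zero y).symm)
    exact ‹P.IsPrime›.ne_top ((Ideal.eq_top_iff_one _).2 ((hx 1).1 (by rw [h0, smul_zero])))
  refine ⟨P', hP'.1.1, lt_of_le_of_ne hPP' (fun h => hyP (h ▸ hyP')), hP'm, z.1, fun r => ?_⟩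
  rw [← hz, ← Submodule.coe_smul, Submodule.coe_eq_zero]

/-- A weakly regular sequence on `M` contained in the prime `m` is at most as long as the
difference of the heights of `m` and of any annihilator prime of `M` contained in it. -/
lemma height_add_length_le {m P : Ideal R} [m.IsPrime] [P.IsPrime] (hPm : P ≤ m) {x : M}
    (hx : ∀ r : R, r • x = 0 ↔ r ∈ P) {rs : List R} (hrs : ∀ r ∈ rs, r ∈ m)
    (hreg : IsWeaklyRegular M rs) : P.height + rs.length ≤ m.height := by
  induction rs generalizing M P with
  | nil => simpa using Ideal.height_mono hPm
  | cons y rs ih =>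
    rw [isWeaklyRegular_cons_iff] at hreg
    obtain ⟨P', hP', hlt, hle, z, hz⟩ :=
      exists_lt_annihilator_prime_quotSMulTop hPm hx (hrs y (by simp)) hreg.1
    have h1 := ih hle hz (fun r hr => hrs r (by simp [hr])) hreg.2
    have h2 := Ideal.height_add_one_le_of_lt_of_isPrime hlt
    refine le_trans ?_ h1
    rw [List.length_cons, Nat.cast_succ, add_comm (rs.length : ℕ∞), ← add_assoc]
    gcongr

lemma depth_le_height (m : Ideal R) [m.IsPrime] : depth m ≤ m.height := by
  refine iSup_le fun ⟨rs, hreg, hmem⟩ => ?_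
  obtain ⟨P, hP, hPm⟩ := Ideal.exists_minimalPrimes_le (I := Module.annihilator R R) (J := m)
    (fun r hr => by
      have := Module.mem_annihilator.1 hr 1
      simp at this
      simp [this])
  obtain ⟨x, hx⟩ := exists_smul_eq_zero_iff_of_mem_minimalPrimes hP
  have := hP.1.1
  exact le_trans le_add_self (height_add_length_le hPm hx hmem hreg.toIsWeaklyRegular)

end CommutativeAlgebra

/-! ### Finite flat algebras over polynomial rings -/

section PolynomialSubring

open Polynomial in
-- Flatness of `B[X]` keeps `rs` regular; modulo `rs` the ring becomes `(B/rs)[X]`, where a monic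
-- polynomial is a nonzerodivisor.
lemma isWeaklyRegular_map_C_append {B : Type*} [CommRing B] {rs : List B}
    (hrs : IsWeaklyRegular B rs) {g : B[X]} (hg : g.Monic) :
    IsWeaklyRegular B[X] (rs.map (C : B →+* B[X]) ++ [g]) := by
  rw [isWeaklyRegular_append_iff]
  refine ⟨hrs.of_flat, ?_⟩
  rw [isWeaklyRegular_singleton_iff, isSMulRegular_iff_right_eq_zero_of_smul]
  intro f
  obtain ⟨f, rfl⟩ := Submodule.Quotient.mk_surjective _ f
  have key : ∀ f : B[X], f ∈ (Ideal.ofList (rs.map (C : B →+* B[X])) • ⊤ : Ideal B[X]) ↔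
      f.map (Ideal.Quotient.mk (Ideal.ofList rs)) = 0 := by
    intro f
    rw [smul_eq_mul, Ideal.mul_top, ← Ideal.map_ofList, Ideal.mem_map_C_iff, Polynomial.ext_iff]
    simp [Ideal.Quotient.eq_zero_iff_mem]
  rw [← Submodule.Quotient.mk_smul, Submodule.Quotient.mk_eq_zero, Submodule.Quotient.mk_eq_zero,
    key, key, smul_eq_mul, Polynomial.map_mul, (hg.map _).mul_right_eq_zero_iff]
  exact id

/-- Induction on the number of variables. The contraction of `Q` to one variable fewer is maximal
(Jacobson rings), and the residue field is finite over `K` (Nullstellensatz), so the extra variable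
satisfies a monic equation modulo `Q`; this monic polynomial extends the sequence. -/
lemma exists_isWeaklyRegular_of_isMaximal {K : Type*} [Field K] (d : ℕ)
    (Q : Ideal (MvPolynomial (Fin d) K)) [hQ : Q.IsMaximal] :
    ∃ rs : List (MvPolynomial (Fin d) K),
      rs.length = d ∧ (∀ r ∈ rs, r ∈ Q) ∧ IsWeaklyRegular (MvPolynomial (Fin d) K) rs := by
  induction d with
  | zero => exact ⟨[], by simp⟩
  | succ d ih =>
    let e := MvPolynomial.finSuccEquiv K d
    let Q' : Ideal (Polynomial (MvPolynomial (Fin d) K)) := Q.comap (e.symm : _ →+* _)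
    have hQ' : Q'.IsMaximal := Ideal.comap_isMaximal_of_equiv e.symm
    have hq : (Q'.comap (Polynomial.C : MvPolynomial (Fin d) K →+* _)).IsMaximal :=
      Polynomial.isMaximal_comap_C_of_isJacobsonRing Q'
    obtain ⟨rs, hlen, hmem, hreg⟩ := ih (Q'.comap Polynomial.C)
    have : Algebra.FiniteType K (Polynomial (MvPolynomial (Fin d) K) ⧸ Q') :=
      Algebra.FiniteType.trans (S := Polynomial (MvPolynomial (Fin d) K))
        (Algebra.FiniteType.trans (S := MvPolynomial (Fin d) K) inferInstance inferInstance)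
        inferInstance
    let := Ideal.Quotient.field Q'
    have hfin : Module.Finite K (Polynomial (MvPolynomial (Fin d) K) ⧸ Q') :=
      finite_of_finite_type_of_isJacobsonRing K _
    have hint : IsIntegral K (Ideal.Quotient.mk Q' Polynomial.X) :=
      Algebra.IsIntegral.isIntegral _
    obtain ⟨p, hp, hp0⟩ := hint
    let g : Polynomial (MvPolynomial (Fin d) K) := p.map MvPolynomial.C
    have hg : g.Monic := hp.map _
    have hgQ : g ∈ Q' := by
      rw [← Ideal.Quotient.eq_zero_iff_mem, ← hp0]
      exact Polynomial.hom_eval₂ p (Polynomial.C.comp MvPolynomial.C) (Ideal.Quotient.mk Q') _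
    refine ⟨(rs.map Polynomial.C ++ [g]).map e.symm, by simp [hlen], ?_, ?_⟩
    · intro r hr
      obtain ⟨f, hf, rfl⟩ := List.mem_map.1 hr
      change f ∈ Q'
      rcases List.mem_append.1 hf with h | h
      · obtain ⟨b, hb, rfl⟩ := List.mem_map.1 h
        exact hmem b hb
      · rw [List.mem_singleton.1 h]; exact hgQ
    · refine (AddEquiv.isWeaklyRegular_congr (e := e.symm.toAddEquiv) ?_).1
        (isWeaklyRegular_map_C_append hreg hg)
      refine List.forall₂_map_right_iff.2 (List.forall₂_same.2 fun r _ f => ?_)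
      exact map_mul e.symm r f

/-- A ring that is finite and flat over a polynomial ring over a field is Cohen–Macaulay. -/
lemma isCohenMacaulayRing_of_flat_of_finite {K A : Type*} [Field K] [CommRing A] {d : ℕ}
    [Algebra (MvPolynomial (Fin d) K) A] [Module.Finite (MvPolynomial (Fin d) K) A]
    [Module.Flat (MvPolynomial (Fin d) K) A] : IsCohenMacaulayRing A := by
  have hN : IsNoetherianRing A := IsNoetherianRing.of_finite (MvPolynomial (Fin d) K) A
  refine ⟨hN, fun P hP => le_antisymm (depth_le_height P) ?_⟩
  have hQ : (P.comap (algebraMap (MvPolynomial (Fin d) K) A)).IsMaximal :=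
    Ideal.isMaximal_comap_of_isIntegral_of_isMaximal P
  -- Incomparability: strict chains of primes stay strict under contraction along an integral
  -- extension.
  have h1 : P.height ≤ d := by
    have h2 : ringKrullDim A ≤ ringKrullDim (MvPolynomial (Fin d) K) :=
      Order.krullDim_le_of_strictMono
        (PrimeSpectrum.comap (algebraMap (MvPolynomial (Fin d) K) A))
        (fun I J h => Ideal.IsIntegral.comap_lt_comap h)
    rw [MvPolynomial.ringKrullDim_of_isNoetherianRing, ringKrullDim_eq_zero_of_field, zero_add,
      Nat.card_fin] at h2
    have h3 := (Ideal.height_le_ringKrullDim_of_isPrime (I := P)).trans h2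
    exact_mod_cast h3
  obtain ⟨rs, hlen, hmem, hreg⟩ := exists_isWeaklyRegular_of_isMaximal d
    (P.comap (algebraMap (MvPolynomial (Fin d) K) A))
  have hmem' : ∀ r ∈ rs.map (algebraMap (MvPolynomial (Fin d) K) A), r ∈ P := by
    intro r hr
    obtain ⟨s, hs, rfl⟩ := List.mem_map.1 hr
    exact hmem s hs
  refine h1.trans ?_
  have h4 : (((rs.map (algebraMap (MvPolynomial (Fin d) K) A)).length : ℕ) : ℕ∞) ≤ depth P :=
    le_iSup (fun rs : {rs : List A // IsRegular A rs ∧ ∀ r ∈ rs, r ∈ P} => (rs.1.length : ℕ∞))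
      ⟨_, ⟨hreg.of_flat, ?_⟩, hmem'⟩
  · simpa [hlen] using h4
  · rw [smul_eq_mul, Ideal.mul_top]
    exact fun h => hP.ne_top (top_le_iff.1 (h.le.trans (Ideal.span_le.2 hmem')))

end PolynomialSubring

/-! ### Ideals of fold products and their colon ideals -/

section Fold

variable {R ι : Type*} [CommRing R] [DecidableEq ι] (ℓ : ι → R)

/-- The ideal generated by the `a`-fold products of the elements `ℓ i` with `i ∈ s`. -/
def foldIdealOn (s : Finset ι) (a : ℕ) : Ideal R :=
  Ideal.span {f | ∃ t ⊆ s, t.card = a ∧ f = ∏ i ∈ t, ℓ i}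

variable {ℓ}

omit [DecidableEq ι] in
lemma foldIdealOn_zero (s : Finset ι) : foldIdealOn ℓ s 0 = ⊤ :=
  (Ideal.eq_top_iff_one _).2 (Ideal.subset_span ⟨∅, by simp⟩)

omit [DecidableEq ι] in
lemma foldIdealOn_eq_bot {s : Finset ι} {a : ℕ} (h : s.card < a) : foldIdealOn ℓ s a = ⊥ := by
  rw [foldIdealOn, Ideal.span_eq_bot]
  rintro f ⟨t, hts, rfl, -⟩
  exact absurd (Finset.card_le_card hts) (not_le.2 h)

omit [DecidableEq ι] in
lemma foldIdealOn_mono {s s' : Finset ι} (h : s ⊆ s') (a : ℕ) :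
    foldIdealOn ℓ s a ≤ foldIdealOn ℓ s' a :=
  Ideal.span_mono fun _ ⟨t, hts, ht⟩ => ⟨t, hts.trans h, ht⟩

lemma foldIdealOn_succ_le (s : Finset ι) (a : ℕ) :
    foldIdealOn ℓ s (a + 1) ≤ foldIdealOn ℓ s a := by
  refine Ideal.span_le.2 ?_
  rintro f ⟨t, hts, hta, rfl⟩
  obtain ⟨i, hi⟩ : t.Nonempty := Finset.card_pos.1 (by omega)
  rw [← Finset.mul_prod_erase t ℓ hi]
  refine Ideal.mul_mem_left _ _ (Ideal.subset_span ⟨t.erase i, ?_, ?_, rfl⟩)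
  · exact (Finset.erase_subset _ _).trans hts
  · rw [Finset.card_erase_of_mem hi, hta, Nat.add_sub_cancel]

lemma foldIdealOn_insert {e : ι} {s : Finset ι} (he : e ∉ s) (a : ℕ) :
    foldIdealOn ℓ (insert e s) (a + 1) =
      foldIdealOn ℓ s (a + 1) ⊔ Ideal.span {ℓ e} * foldIdealOn ℓ s a := by
  refine le_antisymm (Ideal.span_le.2 ?_) (sup_le (foldIdealOn_mono (Finset.subset_insert _ _) _) ?_)
  · rintro f ⟨t, hts, hta, rfl⟩
    by_cases het : e ∈ t
    · rw [← Finset.mul_prod_erase t ℓ het]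
      refine Ideal.mem_sup_right (Ideal.mul_mem_mul (Ideal.mem_span_singleton_self _)
        (Ideal.subset_span ⟨t.erase e, ?_, ?_, rfl⟩))
      · rwa [← Finset.subset_insert_iff]
      · rw [Finset.card_erase_of_mem het, hta, Nat.add_sub_cancel]
    · exact Ideal.mem_sup_left (Ideal.subset_span
        ⟨t, (Finset.subset_insert_iff_of_notMem het).1 hts, hta, rfl⟩)
  · rw [foldIdealOn, Ideal.span_mul_span', Ideal.span_le]
    rintro _ ⟨_, rfl, _, ⟨t, hts, hta, rfl⟩, rfl⟩
    have het : e ∉ t := fun h => he (hts h)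
    exact Ideal.subset_span ⟨insert e t, Finset.insert_subset_insert _ hts,
      by rw [Finset.card_insert_of_notMem het, hta], (Finset.prod_insert het).symm⟩

omit [DecidableEq ι] in
lemma sup_sup_sup_mul_self (I A F G : Ideal R) : I ⊔ (A ⊔ (F ⊔ I * G)) = (I ⊔ A) ⊔ F := by
  rw [← sup_assoc A, ← sup_assoc, ← sup_assoc, sup_eq_left]
  have h : I * G ≤ I := Ideal.mul_le_left
  exact h.trans (le_sup_of_le_left le_sup_left)

/-- An induction principle for ideals of fold products, along the exact sequences
`0 → R ⧸ (J : e) → R ⧸ J → R ⧸ (J + e) → 0`. -/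
lemma foldIdealOn_induction_of_colon (p : Ideal R → Prop) (htop : p ⊤)
    (hext : ∀ (J J' : Ideal R) (e : R), (∀ f, f ∈ J' ↔ e * f ∈ J) → p J' →
      p (Ideal.span {e} ⊔ J) → p J)
    (T : Finset ι) (m : ℕ)
    (hbase : ∀ q ⊆ T, q.card = m → p (Ideal.span (ℓ '' q)))
    (hcolon : ∀ (e : ι) (q s : Finset ι) (c : ℕ), q.card + c + 1 = m → e ∉ q → e ∉ s →
      Disjoint q s → ∀ f, ℓ e * f ∈ Ideal.span (ℓ '' q) ⊔ foldIdealOn ℓ s (s.card + 1 - c) →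
        f ∈ Ideal.span (ℓ '' q) ⊔ foldIdealOn ℓ s (s.card + 1 - c))
    (s q : Finset ι) (c : ℕ) (hsT : s ⊆ T) (hqT : q ⊆ T) (hqs : Disjoint q s)
    (hc : q.card + c = m) :
    p (Ideal.span (ℓ '' q) ⊔ foldIdealOn ℓ s (s.card + 1 - c)) := by
  induction s using Finset.induction_on generalizing q c with
  | empty =>
    cases c with
    | zero =>
      rw [foldIdealOn_eq_bot (by simp), sup_bot_eq]
      exact hbase q hqT hc
    | succ c => simpa [foldIdealOn_zero] using htop
  | insert e s he ih =>
    rw [Finset.insert_subset_iff] at hsT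
    rw [Finset.disjoint_insert_right] at hqs
    cases c with
    | zero =>
      rw [foldIdealOn_eq_bot (by simp), sup_bot_eq]
      exact hbase q hqT hc
    | succ c =>
      rw [Finset.card_insert_of_notMem he, Nat.add_sub_add_right]
      -- The truncated difference vanishes when `c > |s|`; the fold ideal is then the whole ring.
      -- Otherwise it is written as `b + 1`.
      rcases Nat.eq_zero_or_eq_succ_pred (s.card + 1 - c) with h0 | h0
      · rw [h0, foldIdealOn_zero, sup_top_eq]; exact htop
      · have hb : (s.card + 1 - c).pred = s.card + 1 - (c + 1) := by omega
        -- By `foldIdealOn_insert`, the colon by `ℓ e` is `(q) + I_b(s)`, which has parameter `c +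
        -- 1`, and adding `ℓ e` gives `(q, e) + I_{b+1}(s)`, with parameter `c`. Both keep the sum
        -- `|q| + c` equal to `m`.
        have h1 := ih q (c + 1) hsT.2 hqT hqs.2 hc
        have h2 := ih (insert e q) c hsT.2 (Finset.insert_subset hsT.1 hqT)
          (Finset.disjoint_insert_left.2 ⟨he, hqs.2⟩)
          (by rw [Finset.card_insert_of_notMem hqs.1]; omega)
        have hcol := hcolon e q s c (by omega) hqs.1 he hqs.2
        rw [← hb] at h1
        rw [h0] at h2 hcol ⊢
        generalize (s.card + 1 - c).pred = b at h1 h2 hcol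
        rw [foldIdealOn_insert he]
        refine hext _ _ (ℓ e) (fun f => ⟨fun hf => ?_, fun hf => ?_⟩) h1 ?_
        · obtain ⟨x, hx, y, hy, rfl⟩ := Submodule.mem_sup.1 hf
          rw [mul_add]
          exact add_mem (Ideal.mem_sup_left (Ideal.mul_mem_left _ _ hx))
            (Ideal.mem_sup_right (Ideal.mem_sup_right
              (Ideal.mul_mem_mul (Ideal.mem_span_singleton_self _) hy)))
        · rw [← sup_assoc] at hf
          obtain ⟨x, hx, y, hy, hxy⟩ := Submodule.mem_sup.1 hf
          obtain ⟨z, hz, rfl⟩ := Ideal.mem_span_singleton_mul.1 hy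
          have h3 := hcol (f - z) (by
            rw [mul_sub, ← hxy, add_sub_cancel_right]; exact hx)
          have hle : Ideal.span (ℓ '' q) ⊔ foldIdealOn ℓ s (b + 1) ≤
              Ideal.span (ℓ '' q) ⊔ foldIdealOn ℓ s b :=
            sup_le le_sup_left (le_sup_of_le_right (foldIdealOn_succ_le s b))
          have h4 := hle h3
          have h5 := add_mem h4 (Ideal.mem_sup_right hz)
          rwa [sub_add_cancel] at h5
        · rwa [sup_sup_sup_mul_self, ← Ideal.span_insert, ← Set.image_insert_eq, ← Finset.coe_insert]

/-- Being a nonzerodivisor modulo an ideal passes through the same exact sequences, so the induction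
principle applies to this property. Its colon hypothesis is the present claim at level `|q| + c -
1`, hence the strong induction. -/
lemma mem_of_mul_mem_foldIdealOn (m : ℕ)
    (hprime : ∀ (e : ι) (q : Finset ι), e ∉ q → q.card ≤ m → ∀ f,
      ℓ e * f ∈ Ideal.span (ℓ '' q) → f ∈ Ideal.span (ℓ '' q))
    (e : ι) (q s : Finset ι) (c : ℕ) (hc : q.card + c ≤ m) (heq : e ∉ q) (hes : e ∉ s)
    (hqs : Disjoint q s) (f : R)
    (hf : ℓ e * f ∈ Ideal.span (ℓ '' q) ⊔ foldIdealOn ℓ s (s.card + 1 - c)) :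
    f ∈ Ideal.span (ℓ '' q) ⊔ foldIdealOn ℓ s (s.card + 1 - c) := by
  obtain ⟨m', hm'⟩ : ∃ m', q.card + c = m' := ⟨_, rfl⟩
  induction m' using Nat.strong_induction_on generalizing e q s c f with
  | _ m' ih =>
    refine foldIdealOn_induction_of_colon (fun J => ∀ f, ℓ e * f ∈ J → f ∈ J)
      (fun _ _ => trivial) ?_ (q ∪ s) m' ?_ ?_ s q c Finset.subset_union_right
      Finset.subset_union_left hqs hm' f hf
    · intro J J' a hJ hJ' hJa f hf
      obtain ⟨x, hx, y, hy, rfl⟩ := Submodule.mem_sup.1 (hJa f (Ideal.mem_sup_right hf))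
      obtain ⟨g, rfl⟩ := Ideal.mem_span_singleton'.1 hx
      refine add_mem ?_ hy
      rw [mul_comm, ← hJ]
      refine hJ' g ((hJ _).2 ?_)
      have h := sub_mem hf (J.mul_mem_left (ℓ e) hy)
      convert h using 1
      ring
    · intro q' hq' hcard
      exact hprime e q' (fun h => (Finset.mem_union.1 (hq' h)).elim heq hes) (by omega)
    · intro e' q' s' c' hc' heq' hes' hqs' f hf
      exact ih _ (by omega) e' q' s' c' (by omega) heq' hes' hqs' f hf rfl

/-- The special case of `foldIdealOn_induction_of_colon` in which the elements `ℓ i` are such that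
each one is a nonzerodivisor modulo fewer than `m` others. -/
lemma foldIdealOn_induction (p : Ideal R → Prop) (htop : p ⊤)
    (hext : ∀ (J J' : Ideal R) (e : R), (∀ f, f ∈ J' ↔ e * f ∈ J) → p J' →
      p (Ideal.span {e} ⊔ J) → p J)
    (m : ℕ) (hbase : ∀ q : Finset ι, q.card = m → p (Ideal.span (ℓ '' q)))
    (hprime : ∀ (e : ι) (q : Finset ι), e ∉ q → q.card < m → ∀ f,
      ℓ e * f ∈ Ideal.span (ℓ '' q) → f ∈ Ideal.span (ℓ '' q)) (s : Finset ι) :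
    p (foldIdealOn ℓ s (s.card + 1 - m)) := by
  have := foldIdealOn_induction_of_colon (ℓ := ℓ) p htop hext s m (fun q _ => hbase q)
    (fun e q s c hc heq hes hqs f hf => mem_of_mul_mem_foldIdealOn (m - 1)
      (fun e q heq hq => hprime e q heq (by omega)) e q s c (by omega) heq hes hqs f hf)
    s ∅ m subset_rfl (Finset.empty_subset _) (Finset.disjoint_empty_left _) (by simp)
  simpa using this

end Fold

/-! ### Splitting the colon sequence -/

section Projective

/-- Multiplication by `e` gives the exact sequence `0 → R/J' → R/J → R/(e, J) → 0`, which splits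
over `S` because its last term is projective; `R/J` is then a direct sum of the outer terms. -/
lemma finite_projective_quotient_of_colon {S R : Type*} [CommRing S] [CommRing R] [Algebra S R]
    {J J' : Ideal R} {e : R} (h : ∀ f, f ∈ J' ↔ e * f ∈ J)
    (h₁ : Module.Finite S (R ⧸ J') ∧ Module.Projective S (R ⧸ J'))
    (h₂ : Module.Finite S (R ⧸ (Ideal.span {e} ⊔ J)) ∧
      Module.Projective S (R ⧸ (Ideal.span {e} ⊔ J))) :
    Module.Finite S (R ⧸ J) ∧ Module.Projective S (R ⧸ J) := by
  obtain ⟨_, _⟩ := h₁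
  obtain ⟨_, _⟩ := h₂
  let g : (R ⧸ J) →ₗ[S] (R ⧸ (Ideal.span {e} ⊔ J)) :=
    (Ideal.Quotient.factorₐ S (le_sup_right : J ≤ Ideal.span {e} ⊔ J)).toLinearMap
  have hg : Function.Surjective g := Ideal.Quotient.factor_surjective le_sup_right
  let f : (R ⧸ J') →ₗ[S] (R ⧸ J) :=
    (Submodule.mapQ J' J (LinearMap.mulLeft R e) (fun x hx => (h x).1 hx)).restrictScalars S
  have hf : Function.Injective f := by
    rw [injective_iff_map_eq_zero]
    intro x hx
    obtain ⟨x, rfl⟩ := Ideal.Quotient.mk_surjective x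
    have hx' : Ideal.Quotient.mk J (e * x) = 0 := hx
    rw [Ideal.Quotient.eq_zero_iff_mem] at hx' ⊢
    exact (h x).2 hx'
  have hfg : Function.Exact f g := by
    intro x
    obtain ⟨x, rfl⟩ := Ideal.Quotient.mk_surjective x
    have hgx : g (Ideal.Quotient.mk J x) = Ideal.Quotient.mk (Ideal.span {e} ⊔ J) x := rfl
    rw [hgx, Ideal.Quotient.eq_zero_iff_mem]
    constructor
    · intro hx
      obtain ⟨a, ha, b, hb, rfl⟩ := Submodule.mem_sup.1 hx
      obtain ⟨y, rfl⟩ := Ideal.mem_span_singleton'.1 ha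
      refine ⟨Ideal.Quotient.mk J' y, ?_⟩
      change Ideal.Quotient.mk J (e * y) = _
      rw [Ideal.Quotient.eq]
      convert J.neg_mem hb using 1
      ring
    · rintro ⟨y, hy⟩
      obtain ⟨y, rfl⟩ := Ideal.Quotient.mk_surjective y
      have hy' : Ideal.Quotient.mk J (e * y) = Ideal.Quotient.mk J x := hy
      rw [Ideal.Quotient.eq] at hy'
      have := sub_mem (Ideal.mem_sup_left (Ideal.mul_mem_right y _
        (Ideal.mem_span_singleton_self e))) (Ideal.mem_sup_right (S := Ideal.span {e}) hy')
      rwa [sub_sub_cancel] at this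
  obtain ⟨l, hl⟩ := Module.projective_lifting_property g LinearMap.id hg
  let E := (hfg.splitSurjectiveEquiv hf ⟨l, hl⟩).1
  exact ⟨Module.Finite.equiv E.symm, Module.Projective.of_equiv E.symm⟩

end Projective

/-! ### Linear forms, linear primes and generic complements -/

section LinearForms

open MvPolynomial Module

variable {K : Type*} [Field K] {k d : ℕ}

/-- The linear form with coefficient vector `v`. -/
noncomputable def linForm : (Fin k → K) →ₗ[K] MvPolynomial (Fin k) K :=
  Fintype.linearCombination K X

lemma linForm_apply (v : Fin k → K) : linForm v = ∑ i, v i • (X i : MvPolynomial (Fin k) K) :=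
  Fintype.linearCombination_apply K _ v

@[simp]
lemma linForm_single (i : Fin k) : linForm (Pi.single i (1 : K)) = X i := by
  simp [linForm, Fintype.linearCombination_apply_single]

lemma linForm_injective : Function.Injective (linForm : (Fin k → K) →ₗ[K] _) := by
  exact (linearIndependent_X (Fin k) K).fintypeLinearCombination_injective

lemma exists_linForm_eq {f : MvPolynomial (Fin k) K} (hf : f.IsHomogeneous 1) :
    ∃ v, linForm v = f := by
  rw [← mem_homogeneousSubmodule, homogeneousSubmodule_one_eq_span_X,
    ← Fintype.range_linearCombination K] at hf
  exact hf

@[simp]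
lemma constantCoeff_linForm (v : Fin k → K) : constantCoeff (linForm v) = 0 := by
  simp [linForm_apply]

/-- The homomorphism of polynomial rings that acts on linear forms as `L`. -/
noncomputable def symMap (L : (Fin k → K) →ₗ[K] (Fin d → K)) :
    MvPolynomial (Fin k) K →ₐ[K] MvPolynomial (Fin d) K :=
  aeval fun i => linForm (L (Pi.single i 1))

@[simp]
lemma symMap_X (L : (Fin k → K) →ₗ[K] (Fin d → K)) (i : Fin k) :
    symMap L (X i) = linForm (L (Pi.single i 1)) := aeval_X _ _

@[simp]
lemma symMap_linForm (L : (Fin k → K) →ₗ[K] (Fin d → K)) (v : Fin k → K) :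
    symMap L (linForm v) = linForm (L v) := by
  have : (symMap L).toLinearMap ∘ₗ linForm = linForm ∘ₗ L := by
    refine LinearMap.pi_ext' fun i => LinearMap.ext_ring ?_
    simp
  exact LinearMap.congr_fun this v

lemma symMap_symMap_of_comp_eq_id {L : (Fin k → K) →ₗ[K] (Fin d → K)}
    {σ : (Fin d → K) →ₗ[K] (Fin k → K)} (h : L ∘ₗ σ = LinearMap.id)
    (f : MvPolynomial (Fin d) K) : symMap L (symMap σ f) = f := by
  have : (symMap L).comp (symMap σ) = AlgHom.id K _ := by
    ext1 i
    have h1 : L (σ (Pi.single i 1)) = Pi.single i 1 := LinearMap.congr_fun h _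
    simp [h1]
  exact DFunLike.congr_fun this f

lemma sub_symMap_symMap_mem {L : (Fin k → K) →ₗ[K] (Fin d → K)}
    {σ : (Fin d → K) →ₗ[K] (Fin k → K)} (h : L ∘ₗ σ = LinearMap.id)
    (f : MvPolynomial (Fin k) K) :
    f - symMap σ (symMap L f) ∈ Ideal.span (linForm '' (L.ker : Set (Fin k → K))) := by
  rw [← Ideal.Quotient.eq]
  have : (Ideal.Quotient.mkₐ K (Ideal.span (linForm '' (L.ker : Set (Fin k → K))))) =
      (Ideal.Quotient.mkₐ K _).comp ((symMap σ).comp (symMap L)) := by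
    ext1 i
    change Ideal.Quotient.mk _ _ = Ideal.Quotient.mk _ (symMap σ (symMap L (X i)))
    rw [Ideal.Quotient.eq]
    refine Ideal.subset_span ⟨Pi.single i 1 - σ (L (Pi.single i 1)), ?_, by simp⟩
    have h1 : L (σ (L (Pi.single i 1))) = L (Pi.single i 1) := LinearMap.congr_fun h _
    simp [h1]
  exact DFunLike.congr_fun this f

lemma span_linForm_ker {L : (Fin k → K) →ₗ[K] (Fin d → K)}
    {σ : (Fin d → K) →ₗ[K] (Fin k → K)} (h : L ∘ₗ σ = LinearMap.id) :
    Ideal.span (linForm '' (L.ker : Set (Fin k → K))) = RingHom.ker (symMap L) := by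
  refine le_antisymm (Ideal.span_le.2 ?_) fun f hf => ?_
  · rintro _ ⟨v, hv, rfl⟩
    have hv' : L v = 0 := hv
    simp [hv']
  · have h1 := sub_symMap_symMap_mem h f
    rwa [(RingHom.mem_ker).1 hf, map_zero, sub_zero] at h1

lemma exists_ker_eq (U : Submodule K (Fin k → K)) (hd : finrank K U + d = k) :
    ∃ (L : (Fin k → K) →ₗ[K] (Fin d → K)) (σ : (Fin d → K) →ₗ[K] (Fin k → K)),
      L ∘ₗ σ = LinearMap.id ∧ L.ker = U := by
  have h1 := U.finrank_quotient_add_finrank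
  rw [finrank_fin_fun] at h1
  let e : ((Fin k → K) ⧸ U) ≃ₗ[K] (Fin d → K) :=
    LinearEquiv.ofFinrankEq _ _ (by rw [finrank_fin_fun]; omega)
  have hsurj : Function.Surjective (e.toLinearMap ∘ₗ U.mkQ) :=
    e.surjective.comp U.mkQ_surjective
  obtain ⟨σ, hσ⟩ := LinearMap.exists_rightInverse_of_surjective _ (LinearMap.range_eq_top.2 hsurj)
  exact ⟨_, σ, hσ, by rw [LinearEquiv.ker_comp, Submodule.ker_mkQ]⟩

lemma finrank_le_dim (U : Submodule K (Fin k → K)) : finrank K U ≤ k := by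
  simpa using U.finrank_le

lemma span_linForm_eq_ker (U : Submodule K (Fin k → K)) :
    ∃ (d : ℕ) (L : (Fin k → K) →ₗ[K] (Fin d → K)), L.ker = U ∧
      Ideal.span (linForm '' (U : Set (Fin k → K))) = RingHom.ker (symMap L) := by
  obtain ⟨L, σ, h, hL⟩ := exists_ker_eq U (Nat.add_sub_of_le (finrank_le_dim U))
  have h2 := span_linForm_ker h
  rw [hL] at h2
  exact ⟨_, L, hL, h2⟩

instance isPrime_span_linForm (U : Submodule K (Fin k → K)) :
    (Ideal.span (linForm '' (U : Set (Fin k → K)))).IsPrime := by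
  obtain ⟨d, L, -, h⟩ := span_linForm_eq_ker U
  rw [h]
  exact RingHom.ker_isPrime _

@[simp]
lemma linForm_mem_span_iff {U : Submodule K (Fin k → K)} {v : Fin k → K} :
    linForm v ∈ Ideal.span (linForm '' (U : Set (Fin k → K))) ↔ v ∈ U := by
  obtain ⟨d, L, hL, h⟩ := span_linForm_eq_ker U
  rw [h, RingHom.mem_ker, symMap_linForm, map_eq_zero_iff _ linForm_injective,
    ← LinearMap.mem_ker, hL]

lemma span_linForm_span (s : Set (Fin k → K)) :
    Ideal.span (linForm '' (Submodule.span K s : Set (Fin k → K))) =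
      Ideal.span (linForm '' s) := by
  refine le_antisymm (Ideal.span_le.2 ?_) (Ideal.span_mono (Set.image_mono Submodule.subset_span))
  rintro _ ⟨v, hv, rfl⟩
  have : Submodule.span K s ≤
      ((Ideal.span (linForm '' s)).restrictScalars K).comap (linForm : (Fin k → K) →ₗ[K] _) :=
    Submodule.span_le.2 fun v hv => Ideal.subset_span ⟨v, hv, rfl⟩
  exact this hv

lemma finrank_le_height_span_linForm (U : Submodule K (Fin k → K)) :
    (finrank K U : ℕ∞) ≤ (Ideal.span (linForm '' (U : Set (Fin k → K)))).height := by
  obtain ⟨n, hn⟩ : ∃ n, finrank K U = n := ⟨_, rfl⟩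
  induction n generalizing U with
  | zero => simp [hn]
  | succ n ih =>
    have hpos : 0 < finrank K U := by omega
    obtain ⟨b⟩ : Nonempty (Basis (Fin (n + 1)) K U) := ⟨finBasisOfFinrankEq K U hn⟩
    let U' : Submodule K (Fin k → K) :=
      Submodule.span K (Set.range fun i : Fin n => (b i.castSucc : Fin k → K))
    have hb : LinearIndependent K fun i => (b i : Fin k → K) :=
      b.linearIndependent.map' U.subtype U.ker_subtype
    have hU' : finrank K U' = n := by
      exact (finrank_span_eq_card (hb.comp _ (Fin.castSucc_injective n))).trans (Fintype.card_fin n)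
    have hle : U' ≤ U := Submodule.span_le.2 (by rintro _ ⟨i, rfl⟩; exact (b _).2)
    have hlt : U' < U := lt_of_le_of_ne hle (by rintro h; rw [h] at hU'; omega)
    have h1 := ih U' hU'
    obtain ⟨v, hvU, hv⟩ := SetLike.exists_of_lt hlt
    have h2 : Ideal.span (linForm '' (U' : Set (Fin k → K))) <
        Ideal.span (linForm '' (U : Set (Fin k → K))) :=
      SetLike.lt_iff_le_and_exists.2 ⟨Ideal.span_mono (Set.image_mono hle), linForm v,
        linForm_mem_span_iff.2 hvU, fun h => hv (linForm_mem_span_iff.1 h)⟩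
    have h3 := Ideal.height_add_one_le_of_lt_of_isPrime h2
    rw [hU'] at h1
    rw [hn, Nat.cast_succ]
    exact le_trans (by gcongr) h3

/-- The lower bound comes from a flag of subspaces, which gives a strict chain of primes; the upper
bound is Krull's height theorem applied to a basis. -/
lemma height_span_linForm (U : Submodule K (Fin k → K)) :
    (Ideal.span (linForm '' (U : Set (Fin k → K)))).height = finrank K U := by
  refine le_antisymm ?_ (finrank_le_height_span_linForm U)
  let b := finBasis K U
  have h1 : Submodule.span K (Set.range fun i => (b i : Fin k → K)) = U := by
    have := congrArg (Submodule.map U.subtype) b.span_eq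
    rw [Submodule.map_span, Submodule.map_top, Submodule.range_subtype, ← Set.range_comp] at this
    exact this
  have h2 : (Ideal.span (linForm '' (U : Set (Fin k → K)))).spanFinrank ≤ finrank K U := by
    rw [← h1, span_linForm_span, ← Set.range_comp, h1]
    refine (Submodule.spanFinrank_span_le_ncard_of_finite (Set.finite_range _)).trans ?_
    rw [← Set.image_univ]
    refine (Set.ncard_image_le Set.finite_univ).trans ?_
    simp [Set.ncard_univ]
  refine (Ideal.height_le_spanFinrank _ (Ideal.IsPrime.ne_top inferInstance)).trans ?_
  exact_mod_cast h2

lemma rank_linForm {n : ℕ} (v : Fin n → Fin k → K) :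
    rank (fun i => linForm (v i)) = finrank K (Submodule.span K (Set.range v)) := by
  rw [rank, ← height_span_linForm, span_linForm_span, ← Set.range_comp]
  rfl

/-- A vector space over an infinite field is not a finite union of proper subspaces. So one vector
can be chosen outside every proper `U t`; adding it lowers each nonzero codimension. -/
lemma exists_common_complement [Infinite K] {τ : Type*} [Finite τ]
    (U : τ → Submodule K (Fin k → K)) (d : ℕ) (hd : ∀ t, k ≤ finrank K (U t) + d) :
    ∃ θ : Fin d → Fin k → K, ∀ t, U t ⊔ Submodule.span K (Set.range θ) = ⊤ := by
  induction d generalizing U with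
  | zero =>
    refine ⟨Fin.elim0, fun t => ?_⟩
    have : U t = ⊤ := Submodule.eq_top_of_finrank_eq
      (by have := finrank_le_dim (U t); have := hd t; rw [finrank_fin_fun]; omega)
    rw [this, top_sup_eq]
  | succ d ih =>
    classical
    let := Fintype.ofFinite τ
    obtain ⟨v, hv⟩ : ∃ v : Fin k → K, ∀ t, v ∈ U t → U t = ⊤ := by
      have h := Subspace.biUnion_ne_univ_of_top_notMem
        (s := (Finset.univ.image U).filter (· ≠ ⊤)) (by simp)
      obtain ⟨v, hv⟩ := (Set.ne_univ_iff_exists_notMem _).1 h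
      refine ⟨v, fun t ht => ?_⟩
      by_contra hne
      exact hv (Set.mem_iUnion₂.2 ⟨U t, by simp [hne], ht⟩)
    obtain ⟨θ, hθ⟩ := ih (fun t => U t ⊔ Submodule.span K {v}) (fun t => by
      by_cases h : v ∈ U t
      · rw [hv t h, top_sup_eq, finrank_top, finrank_fin_fun]; omega
      · have hlt : U t < U t ⊔ Submodule.span K {v} := by
          refine lt_of_le_of_ne le_sup_left fun h' => h ?_
          rw [h']
          exact Submodule.mem_sup_right (Submodule.mem_span_singleton_self v)
        have := Submodule.finrank_lt_finrank_of_lt hlt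
        have := hd t
        omega)
    refine ⟨Fin.cons v θ, fun t => ?_⟩
    rw [Fin.range_cons, Submodule.span_insert, ← sup_assoc]
    exact hθ t

end LinearForms

/-! ### The Cohen–Macaulay case -/

section CohenMacaulay

open MvPolynomial Module

variable {K : Type*} [Field K] {k d n : ℕ}

lemma exists_leftInverse_ker_eq {U : Submodule K (Fin k → K)}
    {σ : (Fin d → K) →ₗ[K] (Fin k → K)} (hU : U ⊔ σ.range = ⊤) (hd : finrank K U + d = k) :
    ∃ L : (Fin k → K) →ₗ[K] (Fin d → K), L ∘ₗ σ = LinearMap.id ∧ L.ker = U := by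
  obtain ⟨L, σ', h, rfl⟩ := exists_ker_eq U hd
  have hLσ : Function.Surjective (L ∘ₗ σ) := by
    intro y
    have hy : σ' y ∈ L.ker ⊔ σ.range := by rw [hU]; trivial
    obtain ⟨u, hu, w, ⟨x, rfl⟩, hx⟩ := Submodule.mem_sup.1 hy
    refine ⟨x, ?_⟩
    have hu' : L u = 0 := hu
    have h1 : L (σ' y) = y := LinearMap.congr_fun h y
    rw [← hx, map_add, hu', zero_add] at h1
    exact h1
  let e : (Fin d → K) ≃ₗ[K] (Fin d → K) :=
    LinearEquiv.ofBijective _ ⟨LinearMap.injective_iff_surjective.2 hLσ, hLσ⟩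
  refine ⟨e.symm.toLinearMap ∘ₗ L, LinearMap.ext fun x => ?_, LinearEquiv.ker_comp _ _⟩
  exact e.symm_apply_apply x

lemma image_linForm_comp (v : Fin n → Fin k → K) (q : Set (Fin n)) :
    Ideal.span ((fun i => linForm (v i)) '' q) =
      Ideal.span (linForm '' (Submodule.span K (v '' q) : Set (Fin k → K))) := by
  rw [span_linForm_span, Set.image_image]

lemma finrank_span_image {v : Fin n → Fin k → K} {q : Finset (Fin n)}
    (h : LinearIndepOn K v (q : Set (Fin n))) :
    finrank K (Submodule.span K (v '' (q : Set (Fin n)))) = q.card := by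
  rw [Set.image_eq_range]
  have := finrank_span_eq_card (R := K) (b := fun x : (q : Set (Fin n)) => v x) h
  simpa using this

/-- If any `c` of the forms are linearly independent, then the quotient by the ideal generated by
the products of all but `c - 1` of the forms is Cohen–Macaulay. -/
theorem isCohenMacaulayRing_quotient_foldIdealOn [Infinite K] (v : Fin n → Fin k → K) {c : ℕ}
    (hck : c ≤ k)
    (hv : ∀ t : Finset (Fin n), t.card ≤ c → LinearIndepOn K v (t : Set (Fin n)))
    (s : Finset (Fin n)) :
    IsCohenMacaulayRing
      (MvPolynomial (Fin k) K ⧸ foldIdealOn (fun i => linForm (v i)) s (s.card + 1 - c)) := by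
  obtain ⟨d, rfl⟩ := Nat.exists_eq_add_of_le hck
  obtain ⟨θ, hθ⟩ := exists_common_complement
    (fun t : {t : Finset (Fin n) // t.card = c} =>
      Submodule.span K (v '' ((t : Finset (Fin n)) : Set (Fin n)))) d
    (fun t => by rw [finrank_span_image (hv t t.2.le), t.2])
  let σ : (Fin d → K) →ₗ[K] (Fin (c + d) → K) := Fintype.linearCombination K θ
  have hσ : σ.range = Submodule.span K (Set.range θ) := Fintype.range_linearCombination K θ
  let : Algebra (MvPolynomial (Fin d) K) (MvPolynomial (Fin (c + d)) K) :=
    (symMap σ).toRingHom.toAlgebra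
  have key : ∀ J, J = foldIdealOn (fun i => linForm (v i)) s (s.card + 1 - c) →
      Module.Finite (MvPolynomial (Fin d) K) (MvPolynomial (Fin (c + d)) K ⧸ J) ∧
      Module.Projective (MvPolynomial (Fin d) K) (MvPolynomial (Fin (c + d)) K ⧸ J) := by
    rintro J rfl
    refine foldIdealOn_induction
      (fun J => Module.Finite (MvPolynomial (Fin d) K) (MvPolynomial (Fin (c + d)) K ⧸ J) ∧
        Module.Projective (MvPolynomial (Fin d) K) (MvPolynomial (Fin (c + d)) K ⧸ J))
      ?_ (fun J J' e h h1 h2 => finite_projective_quotient_of_colon h h1 h2) c ?_ ?_ s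
    · have : Subsingleton (MvPolynomial (Fin (c + d)) K ⧸ (⊤ : Ideal (MvPolynomial (Fin (c + d)) K))) :=
        Ideal.Quotient.subsingleton_iff.2 rfl
      exact ⟨inferInstance, inferInstance⟩
    -- The projection along the span of `q` inverts `σ`, so `S → R/(q)` is an isomorphism.
    · intro q hq
      obtain ⟨L, hL, hker⟩ := exists_leftInverse_ker_eq
        (U := Submodule.span K (v '' (q : Set (Fin n)))) (σ := σ) (by rw [hσ]; exact hθ ⟨q, hq⟩)
        (by rw [finrank_span_image (hv q hq.le), hq])
      rw [image_linForm_comp, ← hker]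
      let f := Algebra.linearMap (MvPolynomial (Fin d) K) (MvPolynomial (Fin (c + d)) K ⧸
        Ideal.span (linForm '' (L.ker : Set (Fin (c + d) → K))))
      have hf : Function.Bijective f := by
        constructor
        · rw [injective_iff_map_eq_zero]
          intro x hx
          have hx' : Ideal.Quotient.mk _ (symMap σ x) = 0 := hx
          rw [Ideal.Quotient.eq_zero_iff_mem, span_linForm_ker hL, RingHom.mem_ker,
            symMap_symMap_of_comp_eq_id hL] at hx'
          exact hx'
        · intro x
          obtain ⟨x, rfl⟩ := Ideal.Quotient.mk_surjective x
          exact ⟨symMap L x, (Ideal.Quotient.eq.2 (sub_symMap_symMap_mem hL x)).symm⟩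
      exact ⟨Module.Finite.equiv (LinearEquiv.ofBijective f hf),
        Module.Projective.of_equiv (LinearEquiv.ofBijective f hf)⟩
    · intro e q he hq f hf
      -- The ideal `(q)` is prime, and it misses `ℓ e` because `q` together with `e` is still
      -- independent.
      have hins := hv (insert e q) (by rw [Finset.card_insert_of_notMem he]; omega)
      rw [Finset.coe_insert, linearIndepOn_insert (by simpa using he)] at hins
      rw [image_linForm_comp] at hf ⊢
      refine ((isPrime_span_linForm _).mem_or_mem hf).resolve_left ?_
      rw [linForm_mem_span_iff]
      exact hins.2
  obtain ⟨_, _⟩ := key _ rfl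
  exact isCohenMacaulayRing_of_flat_of_finite (K := K) (d := d)

end CohenMacaulay

/-! ### Failure of Cohen–Macaulayness at the origin -/

section NotCohenMacaulay

open MvPolynomial Module RingTheory.Sequence

variable {K : Type*} [Field K] {k d n : ℕ}

lemma constantCoeff_symMap (L : (Fin k → K) →ₗ[K] (Fin d → K)) (f : MvPolynomial (Fin k) K) :
    constantCoeff (symMap L f) = constantCoeff f := by
  have : (constantCoeff : MvPolynomial (Fin d) K →+* K).comp
      (symMap L : MvPolynomial (Fin k) K →+* MvPolynomial (Fin d) K) = constantCoeff := by
    ext i <;> simp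
  exact DFunLike.congr_fun this f

lemma le_height_ker_constantCoeff :
    (k : ℕ∞) ≤ (RingHom.ker (constantCoeff : MvPolynomial (Fin k) K →+* K)).height := by
  have h := finrank_le_height_span_linForm (⊤ : Submodule K (Fin k → K))
  rw [finrank_top, finrank_fin_fun] at h
  refine h.trans (Ideal.height_mono (Ideal.span_le.2 ?_))
  rintro _ ⟨v, -, rfl⟩
  exact constantCoeff_linForm v

lemma height_le_height_comap_of_surjective {A B : Type*} [CommRing A] [CommRing B] (f : A →+* B)
    (hf : Function.Surjective f) (P : Ideal B) [P.IsPrime] : P.height ≤ (P.comap f).height := by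
  have hmono : StrictMono (PrimeSpectrum.comap f) := fun I J hIJ =>
    lt_of_le_of_ne (Ideal.comap_mono hIJ.le)
      (fun h => hIJ.ne (PrimeSpectrum.comap_injective_of_surjective f hf h))
  have := Order.height_le_height_apply_of_strictMono _ hmono ⟨P, inferInstance⟩
  rwa [← PrimeSpectrum.height_eq_orderHeight, ← PrimeSpectrum.height_eq_orderHeight] at this

/-- A degree argument: the ideal lives in degrees above `s.card`, the degree of the product. It is
carried out on a line through the origin and a point `a` where the product does not vanish. -/
lemma constantCoeff_eq_zero_of_mul_prod_mem [Infinite K] (v : Fin n → Fin k → K)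
    (s : Finset (Fin n)) (hs : ∀ i ∈ s, v i ≠ 0) (r : MvPolynomial (Fin k) K)
    (hr : r * ∏ i ∈ s, linForm (v i) ∈
      foldIdealOn (fun i => linForm (v i)) Finset.univ (s.card + 1)) :
    constantCoeff r = 0 := by
  have hf : ∏ i ∈ s, linForm (v i) ≠ 0 := Finset.prod_ne_zero_iff.2 fun i hi h =>
    hs i hi (linForm_injective (h.trans (map_zero _).symm))
  obtain ⟨a, ha⟩ : ∃ a, eval a (∏ i ∈ s, linForm (v i)) ≠ 0 := by
    by_contra! h
    exact hf (MvPolynomial.funext fun x => by rw [h, map_zero])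
  let φ : MvPolynomial (Fin k) K →ₐ[K] Polynomial K :=
    aeval fun i => Polynomial.C (a i) * Polynomial.X
  have hφ : ∀ w, φ (linForm w) = Polynomial.C (eval a (linForm w)) * Polynomial.X := by
    intro w
    simp only [linForm_apply, map_sum, map_smul, Finset.sum_mul, φ, aeval_X, smul_eval, eval_X]
    refine Finset.sum_congr rfl fun i _ => ?_
    rw [Polynomial.smul_eq_C_mul, Polynomial.C_mul, mul_assoc]
  have hφp : ∀ t : Finset (Fin n), φ (∏ i ∈ t, linForm (v i)) =
      Polynomial.C (eval a (∏ i ∈ t, linForm (v i))) * Polynomial.X ^ t.card := by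
    intro t
    simp only [map_prod, hφ, Finset.prod_mul_distrib, Finset.prod_const]
  have hI : foldIdealOn (fun i => linForm (v i)) Finset.univ (s.card + 1) ≤
      (Ideal.span {(Polynomial.X : Polynomial K) ^ (s.card + 1)}).comap φ := by
    refine Ideal.span_le.2 ?_
    rintro _ ⟨t, -, ht, rfl⟩
    refine Ideal.mem_comap.2 (Ideal.mem_span_singleton.2 ?_)
    rw [← ht, hφp]
    exact dvd_mul_left _ _
  have h1 := Ideal.mem_span_singleton.1 (Ideal.mem_comap.1 (hI hr))
  rw [map_mul, hφp, pow_succ', ← mul_assoc] at h1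
  have h2 := (mul_dvd_mul_iff_right (pow_ne_zero _ Polynomial.X_ne_zero)).1 h1
  have hu : IsUnit (Polynomial.C (eval a (∏ i ∈ s, linForm (v i)))) :=
    Polynomial.isUnit_C.2 (isUnit_iff_ne_zero.2 ha)
  have h3 := (hu.dvd_mul_right).1 h2
  rw [Polynomial.X_dvd_iff] at h3
  have h4 : (Polynomial.constantCoeff).comp (φ : MvPolynomial (Fin k) K →+* Polynomial K) =
      constantCoeff := by
    ext i <;> simp [φ]
  rw [← h4]
  exact h3

/-- If some three of the forms are linearly independent but some other three are not, then the
quotient by the ideal generated by the products of all but two of the forms is not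
Cohen–Macaulay. -/
theorem not_isCohenMacaulayRing_quotient_foldIdealOn [Infinite K] (v : Fin n → Fin k → K)
    (hv : ∀ i, v i ≠ 0) {s t : Finset (Fin n)} (hs : s.card = 3)
    (hsv : LinearIndepOn K v (s : Set (Fin n))) (ht : t.card = 3)
    (htv : finrank K (Submodule.span K (v '' (t : Set (Fin n)))) = 2) :
    ¬ IsCohenMacaulayRing (MvPolynomial (Fin k) K ⧸
      foldIdealOn (fun i => linForm (v i)) Finset.univ (n - 2)) := by
  rintro ⟨-, hCM⟩
  have hn : 3 ≤ n := by simpa [hs] using s.card_le_univ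
  have hk : 3 ≤ k := by
    rw [← hs, ← finrank_span_image hsv]; exact finrank_le_dim _
  obtain ⟨d, rfl⟩ := Nat.exists_eq_add_of_le (le_trans (by norm_num : 2 ≤ 3) hk)
  set U := Submodule.span K (v '' (t : Set (Fin n)))
  set I := foldIdealOn (fun i => linForm (v i)) Finset.univ (n - 2) with hI
  obtain ⟨L, σ, hLσ, hL⟩ := exists_ker_eq U (d := d) (by omega)
  -- A product of `n - 2` forms omits only two of them, so it involves a member of the three-element
  -- set `t`.
  have hIL : ∀ f ∈ I, symMap L f = 0 := by
    have : I ≤ RingHom.ker (symMap L) := by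
      refine Ideal.span_le.2 ?_
      rintro _ ⟨t', -, ht', rfl⟩
      obtain ⟨i, hi⟩ : (t ∩ t').Nonempty := by
        rw [Finset.nonempty_iff_ne_empty]
        intro h
        have h1 := Finset.card_union_add_card_inter t t'
        have h2 := (t ∪ t').card_le_univ
        rw [h, Finset.card_empty] at h1
        rw [Fintype.card_fin] at h2
        omega
      rw [Finset.mem_inter] at hi
      have hvi : L (v i) = 0 := by
        have : v i ∈ L.ker := hL ▸ Submodule.subset_span ⟨i, hi.1, rfl⟩
        exact this
      refine (RingHom.mem_ker).2 ?_
      rw [map_prod]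
      exact Finset.prod_eq_zero hi.2 (by simp [hvi])
    exact this
  let g : MvPolynomial (Fin (2 + d)) K ⧸ I →+* MvPolynomial (Fin d) K :=
    Ideal.Quotient.lift I (symMap L : MvPolynomial (Fin (2 + d)) K →+* _) hIL
  have hg : Function.Surjective g := fun y =>
    ⟨Ideal.Quotient.mk I (symMap σ y), symMap_symMap_of_comp_eq_id hLσ y⟩
  have hcc : Function.Surjective (constantCoeff : MvPolynomial (Fin d) K →+* K) :=
    fun a => ⟨C a, constantCoeff_C _ a⟩
  have hmax := RingHom.ker_isMaximal_of_surjective _ hcc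
  -- The maximal ideal of the origin, written as a pullback along `g` so that its height is at least
  -- that of the origin in `d = k - 2` variables.
  let mA := (RingHom.ker (constantCoeff : MvPolynomial (Fin d) K →+* K)).comap g
  have hmA : mA.IsMaximal := Ideal.comap_isMaximal_of_surjective g hg
  have hdepth : (d : ℕ∞) ≤ depth mA := by
    rw [hCM mA hmA]
    exact le_height_ker_constantCoeff.trans (height_le_height_comap_of_surjective g hg _)
  let m := mA.comap (Ideal.Quotient.mk I)
  have hm : m.IsPrime := Ideal.comap_isPrime _ _
  have hmem : ∀ r, r ∈ m ↔ constantCoeff r = 0 := by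
    intro r
    rw [← constantCoeff_symMap L]
    exact Iff.rfl
  have hmheight : m.height ≤ (2 + d : ℕ) := by
    have h := Ideal.height_le_ringKrullDim_of_isPrime (I := m)
    rw [MvPolynomial.ringKrullDim_of_isNoetherianRing, ringKrullDim_eq_zero_of_field, zero_add,
      Nat.card_fin] at h
    exact WithBot.coe_le_coe.1 h
  have hsc : sᶜ.card + 1 = n - 2 := by rw [Finset.card_compl, hs, Fintype.card_fin]; omega
  -- This product has one factor fewer than the generators of `I`, and multiplying it by any form
  -- from `s` gives a generator. Its annihilator modulo `I` thus lies in `m` and contains a linear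
  -- prime of height 3.
  let f := ∏ i ∈ sᶜ, linForm (v i)
  let N : Submodule (MvPolynomial (Fin (2 + d)) K) (MvPolynomial (Fin (2 + d)) K ⧸ I) :=
    Submodule.span _ {Ideal.Quotient.mk I f}
  have hN : ∀ r, r ∈ Module.annihilator (MvPolynomial (Fin (2 + d)) K) N ↔ r * f ∈ I := by
    intro r
    rw [← Ideal.Quotient.eq_zero_iff_mem (I := I)]
    exact Submodule.mem_annihilator_span_singleton _ _
  have hNm : Module.annihilator (MvPolynomial (Fin (2 + d)) K) N ≤ m := by
    intro r hr
    rw [hN, hI, ← hsc] at hr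
    exact (hmem r).2 (constantCoeff_eq_zero_of_mul_prod_mem v sᶜ (fun i _ => hv i) r hr)
  obtain ⟨P, hP, hPm⟩ := Ideal.exists_minimalPrimes_le hNm
  have hPprime := hP.1.1
  obtain ⟨x, hx⟩ := exists_smul_eq_zero_iff_of_mem_minimalPrimes hP
  have hP3 : (3 : ℕ∞) ≤ P.height := by
    have h := finrank_le_height_span_linForm (Submodule.span K (v '' (s : Set (Fin n))))
    rw [finrank_span_image hsv, hs] at h
    refine le_trans (by exact_mod_cast h) (Ideal.height_mono ?_)
    rw [span_linForm_span, Ideal.span_le]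
    rintro _ ⟨_, ⟨i, hi, rfl⟩, rfl⟩
    refine hP.1.2 ((hN _).2 (Ideal.subset_span ⟨insert i sᶜ, Finset.subset_univ _, ?_, ?_⟩))
    · rw [Finset.card_insert_of_notMem (by simpa using hi), hsc]
    · rw [Finset.prod_insert (by simpa using hi)]
  have hle : depth mA ≤ ((d - 1 : ℕ) : ℕ∞) := by
    refine iSup_le fun ⟨rs, hreg, hrs⟩ => ?_
    obtain ⟨rs, rfl⟩ := (Ideal.Quotient.mk_surjective (I := I)).list_map rs
    have hreg' : IsWeaklyRegular (MvPolynomial (Fin (2 + d)) K ⧸ I) rs :=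
      (isWeaklyRegular_map_algebraMap_iff (R := MvPolynomial (Fin (2 + d)) K) (S := MvPolynomial (Fin (2 + d)) K ⧸ I)
        (M := MvPolynomial (Fin (2 + d)) K ⧸ I) rs).1
          hreg.toIsWeaklyRegular
    have h := height_add_length_le hPm (x := x.1) (fun r => by
      rw [← hx, ← Submodule.coe_smul, Submodule.coe_eq_zero]) (rs := rs)
      (fun r hr => hrs _ (List.mem_map_of_mem hr)) hreg'
    have h2 : ((3 + rs.length : ℕ) : ℕ∞) ≤ (2 + d : ℕ) := by
      refine le_trans ?_ (h.trans hmheight)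
      push_cast
      gcongr
    have h3 : 3 + rs.length ≤ 2 + d := by exact_mod_cast h2
    simp only [List.length_map, Nat.cast_le]
    omega
  -- This is absurd because the independent triple forces `3 ≤ 2 + d`, hence `d ≥ 1`.
  have h4 : d ≤ d - 1 := by exact_mod_cast hdepth.trans hle
  omega

end NotCohenMacaulay

/-! ### Counting 3-dependencies -/

section Dependencies

open MvPolynomial Module

variable {K : Type*} [Field K] {k n : ℕ}

lemma card_pairs (n : ℕ) : Fintype.card (Pairs n) = n.choose 2 := by
  let e : Pairs n ≃ Σ j : Fin n, Fin (j : ℕ) :=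
    { toFun := fun q => ⟨q.1.2, ⟨q.1.1, q.2⟩⟩
      invFun := fun x => ⟨(⟨x.2, x.2.2.trans x.1.2⟩, x.1), x.2.2⟩
      left_inv := fun _ => rfl
      right_inv := fun _ => rfl }
  rw [Fintype.card_congr e, Fintype.card_sigma]
  simp only [Fintype.card_fin]
  rw [Fin.sum_univ_eq_sum_range (fun i => i), Finset.sum_range_id, Nat.choose_two_right]

lemma dotProduct_circuitVector (a : Pairs n → K) {i₁ i₂ i₃ : Fin n} (h₁₂ : i₁ < i₂) (h₂₃ : i₂ < i₃)
    (c₁ c₂ c₃ : K) :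
    dotProduct a (circuitVector h₁₂ h₂₃ c₁ c₂ c₃) = a ⟨(i₁, i₂), h₁₂⟩ * c₃ +
      a ⟨(i₁, i₃), h₁₂.trans h₂₃⟩ * c₂ + a ⟨(i₂, i₃), h₂₃⟩ * c₁ := by
  rw [circuitVector, dotProduct_add, dotProduct_add, dotProduct_single, dotProduct_single,
    dotProduct_single]

lemma circuitVector_apply_fst {i₁ i₂ i₃ : Fin n} (h₁₂ : i₁ < i₂) (h₂₃ : i₂ < i₃) (c₁ c₂ c₃ : K) :
    circuitVector h₁₂ h₂₃ c₁ c₂ c₃ ⟨(i₁, i₂), h₁₂⟩ = c₃ := by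
  simp [circuitVector, h₁₂.ne, h₂₃.ne]

lemma circuitVector_apply_of_ne {i₁ i₂ i₃ : Fin n} (h₁₂ : i₁ < i₂) (h₂₃ : i₂ < i₃) (c₁ c₂ c₃ : K)
    {q : Pairs n} (hq : q ≠ ⟨(i₁, i₂), h₁₂⟩) (hq₃ : q.1.2 ≠ i₃) :
    circuitVector h₁₂ h₂₃ c₁ c₂ c₃ q = 0 := by
  obtain ⟨⟨a, b⟩, hab⟩ := q
  have h : ¬ (a = i₁ ∧ b = i₂) := by simpa using hq
  have hb : b ≠ i₃ := hq₃
  simp [circuitVector, h, hb]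

lemma numDependencies_eq_zero_iff {ℓ : Fin n → MvPolynomial (Fin k) K}
    (hℓ : ∀ i j, i ≠ j → LinearIndependent K ![ℓ i, ℓ j]) :
    numDependencies ℓ = 0 ↔
      ∀ i₁ i₂ i₃ : Fin n, i₁ < i₂ → i₂ < i₃ → LinearIndependent K ![ℓ i₁, ℓ i₂, ℓ i₃] := by
  rw [numDependencies, Submodule.finrank_eq_zero, dependencySpace, Submodule.span_eq_bot]
  constructor
  · intro h i₁ i₂ i₃ h₁₂ h₂₃
    rw [Fintype.linearIndependent_iff]
    intro g hg
    simp only [Fin.sum_univ_three, Matrix.cons_val] at hg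
    have hp₁₂ := LinearIndependent.pair_iff.1 (hℓ i₁ i₂ h₁₂.ne)
    have hp₁₃ := LinearIndependent.pair_iff.1 (hℓ i₁ i₃ (h₁₂.trans h₂₃).ne)
    have hp₂₃ := LinearIndependent.pair_iff.1 (hℓ i₂ i₃ h₂₃.ne)
    rw [Fin.forall_fin_succ, Fin.forall_fin_two]
    change g 0 = 0 ∧ g 1 = 0 ∧ g 2 = 0
    by_cases h0 : g 0 = 0
    · rw [h0, zero_smul, zero_add] at hg
      exact ⟨h0, hp₂₃ _ _ hg⟩
    by_cases h1 : g 1 = 0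
    · rw [h1, zero_smul, add_zero] at hg
      exact absurd (hp₁₃ _ _ hg).1 h0
    by_cases h2 : g 2 = 0
    · rw [h2, zero_smul, add_zero] at hg
      exact absurd (hp₁₂ _ _ hg).1 h0
    have := h _ ⟨i₁, i₂, i₃, h₁₂, h₂₃, _, _, _, h0, h1, h2, hg, rfl⟩
    have h3 := congrFun this ⟨(i₁, i₂), h₁₂⟩
    rw [circuitVector_apply_fst] at h3
    exact absurd h3 h2
  · rintro h _ ⟨i₁, i₂, i₃, h₁₂, h₂₃, c₁, c₂, c₃, hc, -, -, hrel, rfl⟩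
    have h1 := Fintype.linearIndependent_iff.1 (h i₁ i₂ i₃ h₁₂ h₂₃) ![c₁, c₂, c₃]
      (by simpa [Fin.sum_univ_three] using hrel) 0
    exact absurd h1 hc

/-- If the forms are given by the vectors `(x i, y i)` of the plane, then there are `(n - 1).choose 2`
independent dependencies. -/
lemma numDependencies_succ_eq_choose {m : ℕ} {ℓ : Fin (m + 1) → MvPolynomial (Fin k) K}
    (x y : Fin (m + 1) → K)
    (hrel : ∀ (i₁ i₂ i₃ : Fin (m + 1)) (c₁ c₂ c₃ : K), c₁ • ℓ i₁ + c₂ • ℓ i₂ + c₃ • ℓ i₃ = 0 ↔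
      c₁ * x i₁ + c₂ * x i₂ + c₃ * x i₃ = 0 ∧ c₁ * y i₁ + c₂ * y i₂ + c₃ * y i₃ = 0)
    (hdet : ∀ i j, i ≠ j → x i * y j - x j * y i ≠ 0) :
    numDependencies ℓ = m.choose 2 := by
  let ι : Pairs m → Pairs (m + 1) := fun q => ⟨(q.1.1.castSucc, q.1.2.castSucc), q.2⟩
  have hι : Function.Injective ι := by
    rintro ⟨⟨a, b⟩, h⟩ ⟨⟨a', b'⟩, h'⟩ hq
    simpa [ι] using hq
  let π : dependencySpace ℓ →ₗ[K] (Pairs m → K) :=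
    (LinearMap.funLeft K K ι).domRestrict (dependencySpace ℓ)
  have hinj : Function.Injective π := by
    rw [injective_iff_map_eq_zero]
    rintro ⟨z, hz⟩ hπ
    have h0 : ∀ i j : Fin m, ∀ h : i < j, z ⟨(i.castSucc, j.castSucc), h⟩ = 0 :=
      fun i j h => congrFun hπ ⟨(i, j), h⟩
    -- Divided by the determinants of the pairs, a dependency becomes a multiple of the oriented
    -- triangle `i₁ → i₂ → i₃ → i₁`. The functional `a i` is the boundary at the vertex `i`, so it
    -- vanishes on all dependencies.
    let a : Fin (m + 1) → Pairs (m + 1) → K := fun i q =>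
      ((if q.1.2 = i then 1 else 0) - (if q.1.1 = i then 1 else 0)) /
        (x q.1.1 * y q.1.2 - x q.1.2 * y q.1.1)
    have ha : ∀ i, dotProduct (a i) z = 0 := by
      intro i
      refine Submodule.span_induction (p := fun z _ => dotProduct (a i) z = 0) ?_
        (dotProduct_zero _) (fun u w _ _ hu hw => by rw [dotProduct_add, hu, hw, add_zero])
        (fun c u _ hu => by rw [dotProduct_smul, hu, smul_zero]) hz
      rintro _ ⟨i₁, i₂, i₃, h₁₂, h₂₃, c₁, c₂, c₃, -, -, -, hc, rfl⟩
      obtain ⟨hx, hy⟩ := (hrel _ _ _ _ _ _).1 hc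
      rw [dotProduct_circuitVector]
      have d₁₂ := hdet i₁ i₂ h₁₂.ne
      have d₁₃ := hdet i₁ i₃ (h₁₂.trans h₂₃).ne
      have d₂₃ := hdet i₂ i₃ h₂₃.ne
      have e₁ : c₁ / (x i₂ * y i₃ - x i₃ * y i₂) = c₃ / (x i₁ * y i₂ - x i₂ * y i₁) := by
        rw [div_eq_div_iff d₂₃ d₁₂]
        linear_combination y i₂ * hx - x i₂ * hy
      have e₂ : c₂ / (x i₁ * y i₃ - x i₃ * y i₁) = - (c₃ / (x i₁ * y i₂ - x i₂ * y i₁)) := by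
        rw [← neg_div, div_eq_div_iff d₁₃ d₁₂]
        linear_combination - y i₁ * hx + x i₁ * hy
      simp only [a, div_mul_eq_mul_div, mul_div_assoc, e₁, e₂]
      ring
    -- Once the edges avoiding the last vertex vanish, the only edge left at `i` is the one to the
    -- last vertex, and the boundary equation at `i` kills it.
    have h1 : ∀ i : Fin m, z ⟨(i.castSucc, Fin.last m), i.castSucc_lt_last⟩ = 0 := by
      intro i
      have h2 := ha i.castSucc
      rw [dotProduct, Finset.sum_eq_single ⟨(i.castSucc, Fin.last m), i.castSucc_lt_last⟩] at h2
      · refine (mul_eq_zero.1 h2).resolve_left (div_ne_zero ?_ (hdet _ _ i.castSucc_lt_last.ne))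
        simp [i.castSucc_lt_last.ne']
      · rintro ⟨⟨p, q⟩, hpq⟩ - hne
        have hp : p ≠ Fin.last m := (lt_of_lt_of_le hpq (Fin.le_last q)).ne
        obtain ⟨p, rfl⟩ := Fin.exists_castSucc_eq.2 hp
        by_cases hq : q = Fin.last m
        · subst hq
          have hpi : p ≠ i := by rintro rfl; exact hne rfl
          have : a i.castSucc ⟨(p.castSucc, Fin.last m), hpq⟩ = 0 := by
            simp [a, hpi, i.castSucc_lt_last.ne']
          rw [this, zero_mul]
        · obtain ⟨q, rfl⟩ := Fin.exists_castSucc_eq.2 hq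
          rw [h0 p q hpq, mul_zero]
      · exact fun h => absurd (Finset.mem_univ _) h
    refine Subtype.ext (funext ?_)
    rintro ⟨⟨p, q⟩, hpq⟩
    have hp : p ≠ Fin.last m := (lt_of_lt_of_le hpq (Fin.le_last q)).ne
    obtain ⟨p, rfl⟩ := Fin.exists_castSucc_eq.2 hp
    by_cases hq : q = Fin.last m
    · subst hq; exact h1 p
    · obtain ⟨q, rfl⟩ := Fin.exists_castSucc_eq.2 hq
      exact h0 p q hpq
  have hsurj : Function.Surjective π := by
    rw [← LinearMap.range_eq_top, eq_top_iff, ← (Pi.basisFun K (Pairs m)).span_eq,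
      Submodule.span_le]
    -- The triangle on `i`, `j` and the last vertex has a single edge avoiding the last vertex. Its
    -- coefficients come from Cramer's rule.
    rintro _ ⟨⟨⟨i, j⟩, hij⟩, rfl⟩
    have hij' : i.castSucc < j.castSucc := hij
    have hj := j.castSucc_lt_last
    let c : Fin (m + 1) → Fin (m + 1) → K := fun i j => x i * y j - x j * y i
    have d := hdet _ _ hij'.ne
    have hmem : circuitVector hij' hj (c j.castSucc (Fin.last m)) (- c i.castSucc (Fin.last m))
        (c i.castSucc j.castSucc) ∈ dependencySpace ℓ :=
      Submodule.subset_span ⟨_, _, _, hij', hj, _, _, _, hdet _ _ hj.ne,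
        neg_ne_zero.2 (hdet _ _ (hij'.trans hj).ne), d,
        (hrel _ _ _ _ _ _).2 ⟨by ring, by ring⟩, rfl⟩
    refine ⟨(c i.castSucc j.castSucc)⁻¹ • ⟨_, hmem⟩, funext fun q => ?_⟩
    rw [map_smul, Pi.basisFun_apply, Pi.smul_apply, smul_eq_mul]
    change _ * circuitVector hij' hj _ _ _ (ι q) = _
    by_cases hq : q = ⟨(i, j), hij⟩
    · subst hq
      rw [Pi.single_eq_same]
      exact (congrArg _ (circuitVector_apply_fst hij' hj _ _ _)).trans (inv_mul_cancel₀ d)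
    · rw [Pi.single_eq_of_ne hq, circuitVector_apply_of_ne, mul_zero]
      · exact fun h => hq (hι h)
      · exact (Fin.castSucc_lt_last _).ne
  rw [numDependencies, (LinearEquiv.ofBijective π ⟨hinj, hsurj⟩).finrank_eq, finrank_pi,
    card_pairs]

end Dependencies

/-! ### Rank two, rank at least three, and the conclusion -/

section Main

open MvPolynomial Module

variable {K : Type*} [Field K] {k n : ℕ}

lemma IsArrangement.exists_linForm {ℓ : Fin n → MvPolynomial (Fin k) K} (hℓ : IsArrangement ℓ) :
    ∃ v : Fin n → Fin k → K, ℓ = (fun i => linForm (v i)) ∧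
      ∀ i j, i ≠ j → LinearIndependent K ![v i, v j] := by
  choose v hv using fun i => exists_linForm_eq (hℓ.linear i)
  obtain rfl : (fun i => linForm (v i)) = ℓ := funext hv
  have hunit : ∀ i, ¬ IsUnit (linForm (v i)) := fun i h => by
    have := h.map constantCoeff
    rw [constantCoeff_linForm] at this
    exact not_isUnit_zero this
  refine ⟨v, rfl, fun i j hij => ?_⟩
  -- If `v i` were zero, then `linForm (v j)` would be a common divisor of the two forms, hence a
  -- unit.
  have hi : v i ≠ 0 := fun h => hunit j (hℓ.coprime i j hij (by simp [h]) dvd_rfl)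
  rw [LinearIndependent.pair_iff' hi]
  intro a ha
  refine hunit i (hℓ.coprime i j hij dvd_rfl ?_)
  rw [← ha, map_smul]
  exact Dvd.intro_left (C a) (smul_eq_C_mul _ _).symm

lemma linearIndepOn_orderEmbOfFin_iff {V : Type*} [AddCommGroup V] [Module K V] (v : Fin n → V)
    (t : Finset (Fin n)) {c : ℕ} (ht : t.card = c) :
    LinearIndepOn K v (t : Set (Fin n)) ↔ LinearIndependent K (v ∘ t.orderEmbOfFin ht) := by
  rw [← linearIndepOn_range_iff (t.orderEmbOfFin ht).injective, Finset.range_orderEmbOfFin]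

lemma linearIndepOn_of_card_eq_two {v : Fin n → Fin k → K}
    (hv : ∀ i j, i ≠ j → LinearIndependent K ![v i, v j]) {t : Finset (Fin n)} (ht : t.card = 2) :
    LinearIndepOn K v (t : Set (Fin n)) := by
  rw [linearIndepOn_orderEmbOfFin_iff v t ht]
  have hvec : v ∘ t.orderEmbOfFin ht = ![v (t.orderEmbOfFin ht 0), v (t.orderEmbOfFin ht 1)] := by
    ext1 i
    fin_cases i <;> rfl
  rw [hvec]
  exact hv _ _ (by simp)

lemma forall_linearIndepOn_card_eq_three_iff {v : Fin n → Fin k → K} :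
    (∀ t : Finset (Fin n), t.card = 3 → LinearIndepOn K v (t : Set (Fin n))) ↔
      ∀ i₁ i₂ i₃ : Fin n, i₁ < i₂ → i₂ < i₃ → LinearIndependent K ![v i₁, v i₂, v i₃] := by
  constructor
  · intro h i₁ i₂ i₃ h₁₂ h₂₃
    have hcard : ({i₁, i₂, i₃} : Finset (Fin n)).card = 3 :=
      Finset.card_eq_three.2 ⟨_, _, _, h₁₂.ne, (h₁₂.trans h₂₃).ne, h₂₃.ne, rfl⟩
    have hmono : StrictMono ![i₁, i₂, i₃] := by
      rw [Fin.strictMono_iff_lt_succ]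
      intro i
      fin_cases i
      exacts [h₁₂, h₂₃]
    have h1 := h _ hcard
    have hrange : ((({i₁, i₂, i₃} : Finset (Fin n))) : Set (Fin n)) = Set.range ![i₁, i₂, i₃] := by
      rw [Matrix.range_cons, Matrix.range_cons_cons_empty, Finset.coe_insert, Finset.coe_pair,
        Set.insert_eq]
    rw [hrange, linearIndepOn_range_iff hmono.injective] at h1
    have hvec : v ∘ ![i₁, i₂, i₃] = ![v i₁, v i₂, v i₃] := by
      ext1 i
      fin_cases i <;> rfl
    rwa [hvec] at h1
  · intro h t ht
    rw [linearIndepOn_orderEmbOfFin_iff v t ht]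
    have hvec : v ∘ t.orderEmbOfFin ht = ![v (t.orderEmbOfFin ht 0), v (t.orderEmbOfFin ht 1),
        v (t.orderEmbOfFin ht 2)] := by
      ext1 i
      fin_cases i <;> rfl
    rw [hvec]
    exact h _ _ _ (by simp) (by simp)

lemma linearIndepOn_of_card_le {V : Type*} [AddCommGroup V] [Module K V] {v : Fin n → V} {c : ℕ}
    (hc : c ≤ n) (h : ∀ t : Finset (Fin n), t.card = c → LinearIndepOn K v (t : Set (Fin n)))
    (t : Finset (Fin n)) (ht : t.card ≤ c) : LinearIndepOn K v (t : Set (Fin n)) := by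
  obtain ⟨t', htt', ht'⟩ := Finset.exists_superset_card_eq ht (by simpa using hc)
  exact (h t' ht').mono (by exact_mod_cast htt')

lemma foldIdeal_eq_foldIdealOn (ℓ : Fin n → MvPolynomial (Fin k) K) (a : ℕ) :
    foldIdeal ℓ a = foldIdealOn ℓ Finset.univ a := by
  simp [foldIdeal, foldIdealOn]

/-- In a plane, any two of the forms span all of them. -/
lemma span_pair_eq {v : Fin n → Fin k → K}
    (hv : ∀ i j, i ≠ j → LinearIndependent K ![v i, v j])
    (hr : finrank K (Submodule.span K (Set.range v)) = 2) {i j : Fin n} (hij : i ≠ j) :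
    Submodule.span K {v i, v j} = Submodule.span K (Set.range v) := by
  refine Submodule.eq_of_le_of_finrank_eq (Submodule.span_mono ?_) ?_
  · rintro _ (rfl | rfl) <;> exact ⟨_, rfl⟩
  · have h := finrank_span_eq_card (hv i j hij)
    rw [Matrix.range_cons_cons_empty] at h
    rw [h, hr, Fintype.card_fin]

/-- A product containing `ℓ e` omits exactly two forms, say `ℓ i` and `ℓ j`. In rank 2 these span `ℓ
e`, so substituting for it gives a combination of products that avoid `e`. -/
lemma foldIdealOn_univ_eq_erase {v : Fin n → Fin k → K}
    (hv : ∀ i j, i ≠ j → LinearIndependent K ![v i, v j])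
    (hr : finrank K (Submodule.span K (Set.range v)) = 2) (e : Fin n) :
    foldIdealOn (fun i => linForm (v i)) Finset.univ (n - 2) =
      foldIdealOn (fun i => linForm (v i)) (Finset.univ.erase e) (n - 2) := by
  rcases Nat.eq_zero_or_eq_succ_pred (n - 2) with h0 | h0
  · rw [h0, foldIdealOn_zero, foldIdealOn_zero]
  generalize ha : (n - 2).pred = a at h0
  have hins : insert e (Finset.univ.erase e) = Finset.univ :=
    Finset.insert_erase (Finset.mem_univ e)
  rw [h0]
  conv_lhs => rw [← hins]
  rw [Nat.succ_eq_add_one, foldIdealOn_insert (Finset.notMem_erase _ _), sup_eq_left]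
  rw [foldIdealOn, foldIdealOn, Ideal.span_mul_span', Ideal.span_le]
  rintro _ ⟨_, rfl, _, ⟨t, hts, hta, rfl⟩, rfl⟩
  have hcard : (Finset.univ.erase e \ t).card = 2 := by
    rw [Finset.card_sdiff_of_subset hts, Finset.card_erase_of_mem (Finset.mem_univ _),
      Finset.card_univ, Fintype.card_fin]
    omega
  obtain ⟨i, j, hij, hijt⟩ := Finset.card_eq_two.1 hcard
  have hi : i ∈ Finset.univ.erase e ∧ i ∉ t := by
    rw [← Finset.mem_sdiff, hijt]; simp
  have hj : j ∈ Finset.univ.erase e ∧ j ∉ t := by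
    rw [← Finset.mem_sdiff, hijt]; simp
  have he : v e ∈ Submodule.span K {v i, v j} := by
    rw [span_pair_eq hv hr hij]
    exact Submodule.subset_span ⟨e, rfl⟩
  obtain ⟨x, y, hxy⟩ := Submodule.mem_span_pair.1 he
  have hprod : ∀ i, i ∈ Finset.univ.erase e ∧ i ∉ t → ∀ x : K,
      (x • linForm (v i)) * ∏ i ∈ t, linForm (v i) ∈
        Ideal.span {f | ∃ t' ⊆ Finset.univ.erase e, t'.card = a + 1 ∧
          f = ∏ i ∈ t', linForm (v i)} := by
    intro i hi x
    rw [smul_eq_C_mul, mul_assoc]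
    refine Ideal.mul_mem_left _ _ (Ideal.subset_span ⟨insert i t,
      Finset.insert_subset hi.1 hts, ?_, (Finset.prod_insert hi.2).symm⟩)
    rw [Finset.card_insert_of_notMem hi.2, hta]
  dsimp only
  rw [← hxy, map_add, map_smul, map_smul, add_mul]
  exact add_mem (hprod i hi x) (hprod j hj y)

lemma numDependencies_eq_choose_of_finrank_eq_two (hn : 2 ≤ n) {v : Fin n → Fin k → K}
    (hv : ∀ i j, i ≠ j → LinearIndependent K ![v i, v j])
    (hr : finrank K (Submodule.span K (Set.range v)) = 2) :
    numDependencies (fun i => linForm (v i)) = (n - 1).choose 2 := by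
  obtain ⟨m, rfl⟩ := Nat.exists_eq_add_of_le' (Nat.one_le_of_lt hn)
  rw [Nat.add_sub_cancel]
  let e : Submodule.span K (Set.range v) ≃ₗ[K] (Fin 2 → K) :=
    LinearEquiv.ofFinrankEq _ _ (by rw [hr, finrank_fin_fun])
  let u : Fin (m + 1) → Submodule.span K (Set.range v) :=
    fun i => ⟨v i, Submodule.subset_span ⟨i, rfl⟩⟩
  refine numDependencies_succ_eq_choose (fun i => e (u i) 0) (fun i => e (u i) 1) ?_ ?_
  · intro i₁ i₂ i₃ c₁ c₂ c₃
    rw [← map_smul, ← map_smul, ← map_smul, ← map_add, ← map_add,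
      map_eq_zero_iff _ linForm_injective]
    have h1 : c₁ • v i₁ + c₂ • v i₂ + c₃ • v i₃ = 0 ↔ c₁ • u i₁ + c₂ • u i₂ + c₃ • u i₃ = 0 := by
      rw [← Submodule.coe_eq_zero]; rfl
    rw [h1, ← map_eq_zero_iff e e.injective, funext_iff, Fin.forall_fin_two]
    simp
  · intro i j hij hdet
    have hpair : ∀ a b : K, a • u i + b • u j = 0 → a = 0 ∧ b = 0 := fun a b h =>
      LinearIndependent.pair_iff.1 (hv i j hij) a b (congrArg Subtype.val h)
    have h2 : ∀ a b : K, a * e (u i) 0 + b * e (u j) 0 = 0 → a * e (u i) 1 + b * e (u j) 1 = 0 →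
        a = 0 ∧ b = 0 := by
      intro a b h0 h1
      refine hpair a b ((map_eq_zero_iff e e.injective).1 ?_)
      rw [funext_iff, Fin.forall_fin_two]
      simpa using ⟨h0, h1⟩
    -- If the determinant vanished, Cramer's rule would give two relations whose coefficients are
    -- forced to be zero; in particular both coordinates of `u i` vanish, contradicting
    -- independence.
    have h3 := h2 (e (u j) 0) (- e (u i) 0) (by ring) (by linear_combination -hdet)
    have h4 := h2 (e (u j) 1) (- e (u i) 1) (by linear_combination hdet) (by ring)
    have h5 := h2 1 0 (by rw [neg_eq_zero.1 h3.2]; ring) (by rw [neg_eq_zero.1 h4.2]; ring)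
    exact one_ne_zero h5.1

lemma isCohenMacaulayRing_of_finrank_eq_two [Infinite K] (hn : 2 ≤ n) {v : Fin n → Fin k → K}
    (hv : ∀ i j, i ≠ j → LinearIndependent K ![v i, v j])
    (hr : finrank K (Submodule.span K (Set.range v)) = 2) :
    IsCohenMacaulayRing (MvPolynomial (Fin k) K ⧸ foldIdeal (fun i => linForm (v i)) (n - 2)) := by
  have e : Fin n := ⟨0, by omega⟩
  -- With `e` removed and `c = 2`, the exponent is `(n - 1) + 1 - 2 = n - 2`, as needed.
  have h := isCohenMacaulayRing_quotient_foldIdealOn v (hr ▸ finrank_le_dim _)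
    (linearIndepOn_of_card_le hn fun t => linearIndepOn_of_card_eq_two hv) (Finset.univ.erase e)
  rw [Finset.card_erase_of_mem (Finset.mem_univ e), Finset.card_univ, Fintype.card_fin,
    Nat.sub_add_cancel (by omega), ← foldIdealOn_univ_eq_erase hv hr] at h
  rwa [foldIdeal_eq_foldIdealOn]

lemma isCohenMacaulayRing_iff_of_three_le_finrank [Infinite K] {v : Fin n → Fin k → K}
    (hv : ∀ i j, i ≠ j → LinearIndependent K ![v i, v j])
    (hr : 3 ≤ finrank K (Submodule.span K (Set.range v))) :
    IsCohenMacaulayRing (MvPolynomial (Fin k) K ⧸ foldIdeal (fun i => linForm (v i)) (n - 2)) ↔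
      ∀ t : Finset (Fin n), t.card = 3 → LinearIndepOn K v (t : Set (Fin n)) := by
  have hn : 3 ≤ n := hr.trans ((finrank_range_le_card v).trans_eq (Fintype.card_fin n))
  rw [foldIdeal_eq_foldIdealOn]
  constructor
  · intro h t ht
    by_contra hdep
    have hv0 : ∀ i, v i ≠ 0 := fun i => by
      obtain ⟨j, hj⟩ : ∃ j : Fin n, i ≠ j := by
        have : Nontrivial (Fin n) := Fin.nontrivial_iff_two_le.2 (by omega)
        obtain ⟨j, hj⟩ := exists_ne i
        exact ⟨j, hj.symm⟩
      exact (hv i j hj).ne_zero 0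
    have hpair : ∀ i j, i ≠ j → LinearIndepOn K v {i, j} := fun i j hij => by
      have := linearIndepOn_of_card_eq_two hv (Finset.card_pair hij)
      simpa using this
    have hfin : ∀ i j, i ≠ j → finrank K (Submodule.span K (v '' {i, j})) = 2 := fun i j hij => by
      have := finrank_span_image (v := v) (q := {i, j}) (by simpa using hpair i j hij)
      rwa [Finset.card_pair hij, Finset.coe_pair] at this
    obtain ⟨i, j, hij⟩ : ∃ i j : Fin n, i ≠ j := ⟨⟨0, by omega⟩, ⟨1, by omega⟩, by simp⟩
    -- Two forms span only a plane, so rank at least 3 supplies a third independent form.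
    obtain ⟨l, hl⟩ : ∃ l, v l ∉ Submodule.span K (v '' {i, j}) := by
      by_contra! hcon
      have hle : Submodule.span K (Set.range v) ≤ Submodule.span K (v '' {i, j}) :=
        Submodule.span_le.2 (Set.range_subset_iff.2 hcon)
      have h1 := Submodule.finrank_mono hle
      rw [hfin _ _ hij] at h1
      omega
    have hl' : l ∉ ({i, j} : Set (Fin n)) :=
      fun h => hl (Submodule.subset_span ⟨l, h, rfl⟩)
    have hind := (linearIndepOn_insert hl').2 ⟨hpair _ _ hij, hl⟩
    refine not_isCohenMacaulayRing_quotient_foldIdealOn v hv0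
      (s := {l, i, j}) (t := t) ?_ (by simpa using hind) ht ?_ h
    · rw [Finset.card_insert_of_notMem (by simpa using hl'), Finset.card_pair hij]
    · obtain ⟨a, b, c, hab, hac, hbc, rfl⟩ := Finset.card_eq_three.1 ht
      have ha : a ∉ ({b, c} : Set (Fin n)) := by simp [hab, hac]
      rw [Finset.coe_insert, Finset.coe_pair, linearIndepOn_insert ha, not_and, not_not] at hdep
      rw [Finset.coe_insert, Finset.coe_pair, Set.image_insert_eq, Submodule.span_insert_eq_span
        (hdep (hpair b c hbc)), hfin b c hbc]
  · intro h
    have h1 := isCohenMacaulayRing_quotient_foldIdealOn v (hr.trans (finrank_le_dim _))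
      (linearIndepOn_of_card_le hn h) Finset.univ
    rwa [Finset.card_univ, Fintype.card_fin, show n + 1 - 3 = n - 2 by omega] at h1

end Main
end FoldProducts

open FoldProducts Module in
theorem corollary2p5 {K : Type*} [Field K] [CharZero K] {k n : ℕ} (hn : 2 ≤ n)
    (ℓ : Fin n → MvPolynomial (Fin k) K) (hℓ : FoldProducts.IsArrangement ℓ) :
    (FoldProducts.IsCohenMacaulayRing
        (MvPolynomial (Fin k) K ⧸ FoldProducts.foldIdeal ℓ (n - 2)) ↔
      (FoldProducts.rank ℓ = 2 ∧ FoldProducts.numDependencies ℓ = (n - 1).choose 2) ∨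
      (3 ≤ FoldProducts.rank ℓ ∧ FoldProducts.numDependencies ℓ = 0)) ∧
    (FoldProducts.rank ℓ = 2 → FoldProducts.numDependencies ℓ = (n - 1).choose 2) ∧
    (FoldProducts.numDependencies ℓ = 0 ↔
      ∀ i₁ i₂ i₃ : Fin n, i₁ < i₂ → i₂ < i₃ → LinearIndependent K ![ℓ i₁, ℓ i₂, ℓ i₃]) := by
  obtain ⟨v, rfl, hv⟩ := hℓ.exists_linForm
  have hpair : ∀ i j, i ≠ j → LinearIndependent K ![linForm (v i), linForm (v j)] := by
    intro i j hij
    rw [LinearIndependent.pair_iff]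
    intro a b hab
    rw [← map_smul, ← map_smul, ← map_add, map_eq_zero_iff _ linForm_injective] at hab
    exact LinearIndependent.pair_iff.1 (hv i j hij) a b hab
  have htriple : ∀ i₁ i₂ i₃, LinearIndependent K ![linForm (v i₁), linForm (v i₂), linForm (v i₃)] ↔
      LinearIndependent K ![v i₁, v i₂, v i₃] := by
    intro i₁ i₂ i₃
    simp only [Fintype.linearIndependent_iff, Fin.sum_univ_three, Matrix.cons_val, ← map_smul,
      ← map_add, map_eq_zero_iff _ linForm_injective]
  have hzero := numDependencies_eq_zero_iff hpair
  have hzero' : numDependencies (fun i => linForm (v i)) = 0 ↔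
      ∀ t : Finset (Fin n), t.card = 3 → LinearIndepOn K v (t : Set (Fin n)) := by
    rw [hzero, forall_linearIndepOn_card_eq_three_iff]
    simp only [htriple]
  have htwo : finrank K (Submodule.span K (Set.range v)) = 2 →
      numDependencies (fun i => linForm (v i)) = (n - 1).choose 2 :=
    numDependencies_eq_choose_of_finrank_eq_two hn hv
  have hr : rank (fun i => linForm (v i)) = (finrank K (Submodule.span K (Set.range v)) : ℕ∞) :=
    rank_linForm v
  have hr2 : rank (fun i => linForm (v i)) = 2 ↔
      finrank K (Submodule.span K (Set.range v)) = 2 := by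
    rw [hr]; norm_cast
  have hr3 : 3 ≤ rank (fun i => linForm (v i)) ↔
      3 ≤ finrank K (Submodule.span K (Set.range v)) := by
    rw [hr]; norm_cast
  refine ⟨?_, fun h => htwo (hr2.1 h), hzero⟩
  rw [hr2, hr3, hzero']
  have hge : 2 ≤ finrank K (Submodule.span K (Set.range v)) := by
    have h := finrank_span_eq_card (hv ⟨0, by omega⟩ ⟨1, by omega⟩ (by simp))
    rw [Fintype.card_fin] at h
    refine h.symm.le.trans ?_
    refine Submodule.finrank_mono (Submodule.span_mono (Set.range_subset_iff.2 fun i => ?_))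
    fin_cases i <;> exact ⟨_, rfl⟩
  rcases hge.eq_or_lt with h | h
  · exact iff_of_true (isCohenMacaulayRing_of_finrank_eq_two hn hv h.symm)
      (Or.inl ⟨h.symm, htwo h.symm⟩)
  · rw [isCohenMacaulayRing_iff_of_three_le_finrank hv h]
    exact ⟨fun h' => Or.inr ⟨h, h'⟩, fun h' => h'.elim (fun h' => absurd h'.1 h.ne') And.right⟩
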